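/- Let $G$ be a Carnot group: a connected and simply connected Lie group whose (finite-dimensional, real) Lie algebra splits as $\mathfrak g=\mathfrak g_1\oplus\dots\oplus\mathfrak g_s$ with $[\mathfrak g_1,\mathfrak g_i]=\mathfrak g_{i+1}$ for $1\le i\le s$, $\mathfrak g_{s+1}=\{0\}$. Put $n_i=\dim\mathfrak g_i$, $n=\sum_i n_i$, $Q=\sum_i i\,n_i$. Assume that $G$ is rational: in exponential coordinates $(x_1,\dots,x_s)\in\mathbb R^{n_1}\times\dots\times\mathbb R^{n_s}$ with respect to a suitable basis adapted to the splitting, the group law (given by the Baker–Campbell–Hausdorff formula) is $(x*x')_i=x_i+x_i'+p_i(x,x')$, where $p_i$ is a vector of polynomials with integer coefficients in the coordinates of $x_1,\dots,x_{i-1},x_1',\dots,x_{i-1}'$. Fix such coordinates. Let $G(\mathbb Z)$ be the set of points with integer coordinates and $\delta_r(x_1,\dots,x_s)=(rx_1,r^2x_2,\dots,r^sx_s)$ for $r>0$. Let $\Lambda=(\lambda_1,\dots,\lambda_s)$ be positive weights such that $$d(g,h)=\|g^{-1}*h\|_{\infty,\Lambda},\qquad \|(x_1,\dots,x_s)\|_{\infty,\Lambda}=\max_{1\le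 i\le s}\ \max_{x\text{ a coordinate of }x_i}|\lambda_i x|^{1/i},$$ satisfies the triangle inequality, and let $B_\Lambda=2^n\prod_{i=1}^s\lambda_i^{-n_i}$ be the Lebesgue measure of a ball of radius one. "Almost every" refers to Lebesgue measure in the coordinates. Suppose $Q\ge 3$ and let $C>0$. (1) For $g\in G$ and $N\in\mathbb N$, the number $A_C(g,N)$ of pairs $(p,q)$ with $p\in G(\mathbb Z)$, $q\in\mathbb N$, $1\le q\le N$ and $d(g,\delta_q^{-1}p)\le Cq^{-(Q+1)/Q}$ is finite, and for every $\epsilon>0$, for almost every $g\in G$, $$A_C(g,N)=B_\Lambda\, C^Q\log N+O\!\left((\log N)^{1/2}(\log\log N)^{3/2+\epsilon}\right)\qquad(N\to\infty),$$ where the implied constant may depend on $g$. (2) Let $\rho$ be a metric on $G$ (or merely a function $G\times G\to\mathbb R$) that is bi-Lipschitz to $d$, i.e. $K^{-1}d\le\rho\le Kd$ for some $K>0$. Then $\rho(g,\delta_q^{-1}p)\le Cq^{-(Q+1)/Q}$ has finitely many solutions with $p\in G(\mathbb Z)$, $1\le q\le N$, for all $g$ and $N$; and there are constants $c_1,c_2>0$,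 independent of $g$, such that for almost every $g\in G$ and all $N\ge N_0(g)$, the number of these solutions is at most $c_2\log N$, while the number of solutions of $\rho(g,\delta_q^{-1}p)<Cq^{-(Q+1)/Q}$ with $p\in G(\mathbb Z)$, $1\le q<N$, is at least $c_1\log N$. In particular both numbers are $\asymp\log N$. -/

import Mathlib

open MeasureTheory Filter Asymptotics Topology

noncomputable section

/-- The right-nested bracket `[a₁, [a₂, […, [aₘ₋₁, aₘ]…]]]` of a list of elements of a Lie ring. -/
def nestedBracket {L : Type*} [LieRing L] : List L → L
  | [] => 0
  | [a] => a
  | a :: b :: l => ⁅a, nestedBracket (b :: l)⁆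

/-- The Baker-Campbell-Hausdorff product `log (exp x exp y)` in a nilpotent real Lie algebra of
step at most `s`, by Dynkin's formula
`∑ₖ (-1)ᵏ⁻¹/k ∑ [x^(r₁) y^(t₁) ⋯ x^(rₖ) y^(tₖ)] / (∑ᵢ (rᵢ + tᵢ) · ∏ᵢ rᵢ! tᵢ!)`, the inner sum being
over all `(rᵢ, tᵢ) ≠ (0, 0)`. Brackets of more than `s` elements vanish, so it suffices to take
`k ≤ s` and `rᵢ, tᵢ ≤ s`. -/
def bch {L : Type*} [LieRing L] [LieAlgebra ℝ L] (s : ℕ) (x y : L) : L :=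
  ∑ k ∈ Finset.Icc 1 s,
    ∑ f ∈ Fintype.piFinset
        (fun _ : Fin k => (Finset.range (s + 1) ×ˢ Finset.range (s + 1)).erase ((0, 0) : ℕ × ℕ)),
      ((-1 : ℝ) ^ (k - 1) / (k : ℝ) *
          (((∑ i, ((f i).1 + (f i).2) : ℕ) : ℝ) *
            ∏ i, (((f i).1.factorial : ℝ) * ((f i).2.factorial : ℝ)))⁻¹) •
        nestedBracket
          (List.ofFn fun i => List.replicate (f i).1 x ++ List.replicate (f i).2 y).flatten

/-- A Carnot group `G` with Lie algebra `L`: the Lie algebra has a splitting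
`L = layer 1 ⊕ ⋯ ⊕ layer s` with `[layer 1, layer i] = layer (i + 1)` and `layer (s + 1) = 0`, and
`G` is the connected and simply connected Lie group of the nilpotent Lie algebra `L`, that is
(through its exponential map) the set `L` with the Baker-Campbell-Hausdorff product. -/
structure CarnotGroup (L G : Type*) [LieRing L] [LieAlgebra ℝ L] [Group G] where
  /-- the number `s` of layers -/
  step : ℕ
  /-- the layers of the Lie algebra, indexed by `1, …, s` (the other ones are trivial) -/
  layer : ℕ → Submodule ℝ L
  layer_zero : layer 0 = ⊥
  layer_of_gt : ∀ i, step < i → layer i = ⊥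
  isInternal : DirectSum.IsInternal layer
  bracket_layer : ∀ i, 1 ≤ i →
    Submodule.span ℝ {z : L | ∃ x ∈ layer 1, ∃ y ∈ layer i, ⁅x, y⁆ = z} = layer (i + 1)
  /-- the exponential map -/
  exp : L ≃ G
  exp_mul_exp : ∀ x y : L, exp x * exp y = exp (bch step x y)

/-- Coordinates that make a Carnot group rational: exponential coordinates with respect to a basis
adapted to the layers, in which the group law is
`(x * y)ⱼ = xⱼ + yⱼ + pⱼ(x, y)` where `pⱼ` is a polynomial with integer coefficients in those
coordinates of `x` and of `y` that belong to lower layers. -/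
structure RationalCoordinates {L G : Type*} [LieRing L] [LieAlgebra ℝ L] [Group G]
    (S : CarnotGroup L G) (ι : Type*) [Fintype ι] where
  basis : Module.Basis ι ℝ L
  /-- `weight j` is the index of the layer to which the `j`-th coordinate belongs -/
  weight : ι → ℕ
  basis_mem : ∀ j, basis j ∈ S.layer (weight j)
  poly : ∀ j, MvPolynomial ({k : ι // weight k < weight j} ⊕ {k : ι // weight k < weight j}) ℤ
  mul_coord : ∀ (g h : G) (j : ι),
    basis.equivFun (S.exp.symm (g * h)) j =
      basis.equivFun (S.exp.symm g) j + basis.equivFun (S.exp.symm h) j +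
        MvPolynomial.aeval
          (Sum.elim (fun k => basis.equivFun (S.exp.symm g) k.1)
            (fun k => basis.equivFun (S.exp.symm h) k.1)) (poly j)

namespace RationalCoordinates

variable {L G ι : Type*} [LieRing L] [LieAlgebra ℝ L] [Group G] [Fintype ι] {S : CarnotGroup L G}

/-- The coordinates of a point of `G`. -/
def coord (R : RationalCoordinates S ι) (g : G) : ι → ℝ :=
  R.basis.equivFun (S.exp.symm g)

/-- The point of `G` with given coordinates. -/
def point (R : RationalCoordinates S ι) (x : ι → ℝ) : G :=
  S.exp (R.basis.equivFun.symm x)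

/-- The integer lattice `G(ℤ)`: the points with integer coordinates. -/
def integerPoints (R : RationalCoordinates S ι) : Set G :=
  {p | ∀ j, ∃ m : ℤ, R.coord p j = m}

/-- The dilation `δ_r (x₁, …, x_s) = (r x₁, …, r^s x_s)`. -/
def dilation (R : RationalCoordinates S ι) (r : ℝ) (g : G) : G :=
  R.point fun j => r ^ R.weight j * R.coord g j

/-- `Q = ∑ᵢ i · dim (layer i)`, each basis vector being counted with the index of its layer. -/
def homDim (R : RationalCoordinates S ι) : ℕ :=
  ∑ j, R.weight j

/-- The `Λ`-weighted infinity gauge: the maximum of `|λᵢ x|^(1/i)` over all layers `i` and all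
coordinates `x` that belong to the `i`-th layer. -/
def infNorm (R : RationalCoordinates S ι) (lam : ℕ → ℝ) (g : G) : ℝ :=
  ⨆ j, |lam (R.weight j) * R.coord g j| ^ (1 / (R.weight j : ℝ))

/-- `d(g, h) = ‖g⁻¹ * h‖` for the `Λ`-weighted infinity gauge. -/
def infDist (R : RationalCoordinates S ι) (lam : ℕ → ℝ) (g h : G) : ℝ :=
  R.infNorm lam (g⁻¹ * h)

/-- `B_Λ = 2ⁿ ∏ᵢ λᵢ^(-nᵢ)`, the Lebesgue measure of a ball of radius one for the `Λ`-weighted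
infinity gauge. -/
def ballConst (R : RationalCoordinates S ι) (lam : ℕ → ℝ) : ℝ :=
  2 ^ Fintype.card ι * ∏ j, (lam (R.weight j))⁻¹

/-- The solutions `(p, q)` of `ρ(g, δ_q⁻¹ p) ≤ C q^(-(Q+1)/Q)` with `p ∈ G(ℤ)`, `1 ≤ q ≤ N`. -/
def solutions (R : RationalCoordinates S ι) (ρ : G → G → ℝ) (C : ℝ) (g : G) (N : ℕ) :
    Set (G × ℕ) :=
  {s | s.1 ∈ R.integerPoints ∧ 1 ≤ s.2 ∧ s.2 ≤ N ∧
    ρ g (R.dilation ((s.2 : ℝ)⁻¹) s.1) ≤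
      C * (s.2 : ℝ) ^ (-(((R.homDim : ℝ) + 1) / (R.homDim : ℝ)))}

/-- The solutions `(p, q)` of `ρ(g, δ_q⁻¹ p) < C q^(-(Q+1)/Q)` with `p ∈ G(ℤ)`, `1 ≤ q < N`. -/
def strictSolutions (R : RationalCoordinates S ι) (ρ : G → G → ℝ) (C : ℝ) (g : G) (N : ℕ) :
    Set (G × ℕ) :=
  {s | s.1 ∈ R.integerPoints ∧ 1 ≤ s.2 ∧ s.2 < N ∧
    ρ g (R.dilation ((s.2 : ℝ)⁻¹) s.1) <
      C * (s.2 : ℝ) ^ (-(((R.homDim : ℝ) + 1) / (R.homDim : ℝ)))}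

end RationalCoordinates

end

/-! Write `Γ` for the integer lattice. Applying the automorphism `δ_q` and multiplying the distance
by `q`, the inequality for `(p, q)` says that `p ∈ Γ` lies within `r_q = C q^(-1/Q)` of `δ_q g`. The
number `f_q(g)` of such `p` is a `Γ`-invariant function of `g`, so it lives on `Γ\G`, a probability
space with the unit cube as fundamental domain. The triangular group law makes Lebesgue measure
left-invariant. Every `δ_q` preserves the measure of `Γ\G`, so `f_q` has mean `a / q` with `a = B_Λ
C^Q`.

The `f_q` are almost uncorrelated. If `q' ≤ q` and `u = gcd(q, q') / q`, unfolding one factor and a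
packing argument bound the mean of `f_q f_q'` by `B_Λ² r_q^Q (r_q' + c u)^Q`
(`setLIntegral_count_mul_count`); the leading term is the product of the means. The excess, summed
over `q ≥ q'`, is `O(1 / q')` by elementary gcd sums (`sum_Icc_gcd_weights_le`); this is where `Q ≥
3` is used. Hence the variance of `∑ f_q` over any block is `O(∑ 1/q)`
(`exists_integral_sq_sum_hits_le`).

Grouping `q` into the blocks `(2^j, 2^(j+1)]` gives variables whose sums over `u ≤ j < v` have
second moment `O(v - u)`. The Rademacher–Menshov and Gál–Koksma argument
(`ae_exists_abs_sum_range_le`) bounds their partial sums almost surely by `v^(1/2) (log v)^(3/2 +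
ε)`; taking `v` of order `log N` and interpolating by monotonicity gives part (1). Part (2) follows
by comparing the solutions for `ρ` with those for `d` and the constants `K C` and `C / (2K)`. -/

open scoped ENNReal

/-! ### Brackets and the Baker–Campbell–Hausdorff product -/

section Brackets

variable {L : Type*} [LieRing L] [LieAlgebra ℝ L]

theorem nestedBracket_map (D : L →ₗ[ℝ] L) (hD : ∀ x y : L, D ⁅x, y⁆ = ⁅D x, D y⁆) :
    ∀ l : List L, D (nestedBracket l) = nestedBracket (l.map D)
  | [] => by simp [nestedBracket]
  | [a] => by simp [nestedBracket]
  | a :: b :: l => by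
      have ih := nestedBracket_map D hD (b :: l)
      simp only [nestedBracket, List.map_cons] at ih ⊢
      rw [hD, ih]

theorem bch_map (D : L →ₗ[ℝ] L) (hD : ∀ x y : L, D ⁅x, y⁆ = ⁅D x, D y⁆) (s : ℕ) (x y : L) :
    D (bch s x y) = bch s (D x) (D y) := by
  simp only [bch, map_sum, map_smul, nestedBracket_map D hD, List.map_flatten, List.map_ofFn]
  refine Finset.sum_congr rfl fun k _ => Finset.sum_congr rfl fun f _ => ?_
  congr 4
  funext i
  simp

theorem exists_nestedBracket_eq_smul (x : L) :
    ∀ l : List L, (∀ a ∈ l, ∃ c : ℝ, a = c • x) → ∃ c : ℝ, nestedBracket l = c • x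
  | [], _ => ⟨0, by simp [nestedBracket]⟩
  | [a], h => by simpa [nestedBracket] using h a (by simp)
  | a :: b :: l, h => by
      obtain ⟨c, hc⟩ := exists_nestedBracket_eq_smul x (b :: l)
        fun a' ha' => h a' (List.mem_cons_of_mem _ ha')
      obtain ⟨d, hd⟩ := h a (by simp)
      exact ⟨0, by simp only [nestedBracket]; rw [hc, hd]; simp⟩

theorem nestedBracket_eq_zero (x : L) (l : List L) (h : ∀ a ∈ l, ∃ c : ℝ, a = c • x)
    (hl : l.length ≠ 1) : nestedBracket l = 0 := by
  match l, h, hl with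
  | [], _, _ => rfl
  | [a], _, hl => simp at hl
  | a :: b :: l, h, _ =>
      obtain ⟨c, hc⟩ := exists_nestedBracket_eq_smul x (b :: l)
        fun a' ha' => h a' (List.mem_cons_of_mem _ ha')
      obtain ⟨d, hd⟩ := h a (by simp)
      simp only [nestedBracket]
      rw [hc, hd]
      simp

/-- A bracket word in multiples of one vector vanishes unless it has length one, so only the pairs
`(1, 0)` and `(0, 1)` with `k = 1` survive in Dynkin's formula. This identifies inverses in the
group with negatives in the Lie algebra. -/
theorem bch_smul_smul (s : ℕ) (hs : 1 ≤ s) (x : L) (a b : ℝ) :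
    bch s (a • x) (b • x) = (a + b) • x := by
  unfold bch
  rw [Finset.sum_eq_single 1]
  · have h1 : ∀ f ∈ Fintype.piFinset
        (fun _ : Fin 1 => (Finset.range (s + 1) ×ˢ Finset.range (s + 1)).erase ((0, 0) : ℕ × ℕ)),
        f ≠ (fun _ => (1, 0)) → f ≠ (fun _ => (0, 1)) →
        nestedBracket (List.ofFn fun i => List.replicate (f i).1 (a • x) ++
          List.replicate (f i).2 (b • x)).flatten = 0 := by
      intro f hf h10 h01
      apply nestedBracket_eq_zero x
      · intro z hz
        simp only [List.ofFn_succ, List.ofFn_zero, List.flatten_cons, List.flatten_nil,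
          List.append_nil, List.mem_append, List.mem_replicate] at hz
        rcases hz with ⟨_, rfl⟩ | ⟨_, rfl⟩
        · exact ⟨a, rfl⟩
        · exact ⟨b, rfl⟩
      · simp only [List.ofFn_succ, List.ofFn_zero, List.flatten_cons, List.flatten_nil,
          List.append_nil, List.length_append, List.length_replicate]
        intro h
        have : f 0 = (1, 0) ∨ f 0 = (0, 1) := by
          rcases hfe : f 0 with ⟨u, v⟩
          rw [hfe] at h
          simp only at h
          rcases Nat.eq_zero_or_pos u with hu | hu
          · right; ext <;> simp <;> omega
          · left; ext <;> simp <;> omega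
        rcases this with h | h
        · exact h10 (funext fun i => by rw [Subsingleton.elim i 0, h])
        · exact h01 (funext fun i => by rw [Subsingleton.elim i 0, h])
    have hne : (fun _ : Fin 1 => ((1, 0) : ℕ × ℕ)) ≠ fun _ => (0, 1) := fun h => by
      simpa using congrFun h 0
    rw [Finset.sum_eq_add_of_mem _ _ _ _ hne]
    · simp [nestedBracket, add_smul]
    · intro f hf h
      rw [h1 f hf h.1 h.2, smul_zero]
    · simp; omega
    · simp; omega
  · intro k hk hk1
    refine Finset.sum_eq_zero fun f hf => ?_
    rw [nestedBracket_eq_zero x, smul_zero]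
    · intro z hz
      simp only [List.mem_flatten, List.mem_ofFn] at hz
      obtain ⟨l, ⟨i, rfl⟩, hz⟩ := hz
      simp only [List.mem_append, List.mem_replicate] at hz
      rcases hz with ⟨_, rfl⟩ | ⟨_, rfl⟩
      · exact ⟨a, rfl⟩
      · exact ⟨b, rfl⟩
    · simp only [List.length_flatten, List.map_ofFn, List.sum_ofFn, Function.comp_apply,
        List.length_append, List.length_replicate]
      have hk' : 2 ≤ k := by
        have := (Finset.mem_Icc.1 hk).1
        omega
      have : ∑ _i : Fin k, 1 ≤ ∑ i, ((f i).1 + (f i).2) := by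
        refine Finset.sum_le_sum fun i _ => ?_
        have := Fintype.mem_piFinset.1 hf i
        have h0 : f i ≠ (0, 0) := (Finset.mem_erase.1 this).1
        by_contra hlt
        exact h0 (by ext <;> simp <;> omega)
      simp at this
      omega
  · intro h
    exact absurd (Finset.mem_Icc.2 ⟨le_rfl, hs⟩) h

end Brackets

/-! ### The grading of the Lie algebra and inverses in the group -/

namespace CarnotGroup

variable {L G : Type*} [LieRing L] [LieAlgebra ℝ L] [Group G]

/-- The axioms only control brackets with the first layer. Higher layers are spanned by brackets
`⁅u, v⁆` with `u` in the first layer, and the Jacobi identity `⁅⁅u, v⁆, y⁆ = ⁅u, ⁅v, y⁆⁆ - ⁅v, ⁅u,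
y⁆⁆` lowers the index. -/
theorem lie_mem_layer (S : CarnotGroup L G) :
    ∀ i j {x y : L}, x ∈ S.layer i → y ∈ S.layer j → ⁅x, y⁆ ∈ S.layer (i + j) := by
  intro i
  have h1 : ∀ j {x y : L}, x ∈ S.layer 1 → y ∈ S.layer j → ⁅x, y⁆ ∈ S.layer (1 + j) := by
    intro j x y hx hy
    rcases Nat.eq_zero_or_pos j with rfl | hj
    · rw [S.layer_zero, Submodule.mem_bot] at hy
      simp [hy]
    · rw [add_comm, ← S.bracket_layer j hj]
      exact Submodule.subset_span ⟨x, hx, y, hy, rfl⟩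
  induction i with
  | zero =>
      intro j x y hx _
      rw [S.layer_zero, Submodule.mem_bot] at hx
      simp [hx]
  | succ i ih =>
      intro j x y hx hy
      rcases Nat.eq_zero_or_pos i with rfl | hi
      · exact h1 j hx hy
      rw [← S.bracket_layer i hi] at hx
      induction hx using Submodule.span_induction with
      | zero => simp
      | add a b _ _ ha hb => rw [add_lie]; exact Submodule.add_mem _ ha hb
      | smul c a _ ha => rw [smul_lie]; exact Submodule.smul_mem _ _ ha
      | mem z hz =>
          obtain ⟨u, hu, v, hv, rfl⟩ := hz
          rw [lie_lie]
          refine Submodule.sub_mem _ ?_ ?_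
          · have := h1 _ hu (ih j hv hy)
            rwa [show 1 + (i + j) = i + 1 + j by ring] at this
          · have := ih _ hv (h1 j hu hy)
            rwa [show i + (1 + j) = i + 1 + j by ring] at this

theorem exp_zero (S : CarnotGroup L G) : S.exp 0 = 1 := by
  have h := S.exp_mul_exp 0 0
  have h0 : bch S.step (0 : L) 0 = 0 := by
    have := bch_map (0 : L →ₗ[ℝ] L) (by simp) S.step 0 0
    simpa using this.symm
  rw [h0] at h
  exact mul_eq_left.1 h

theorem exp_neg (S : CarnotGroup L G) (hs : 1 ≤ S.step) (x : L) : S.exp (-x) = (S.exp x)⁻¹ := by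
  rw [eq_inv_iff_mul_eq_one, S.exp_mul_exp]
  have := bch_smul_smul S.step hs x (-1) 1
  simp only [neg_smul, one_smul, neg_add_cancel, zero_smul] at this
  rw [this, S.exp_zero]

end CarnotGroup

/-! ### Coordinates, dilations and the integer lattice -/

namespace RationalCoordinates

variable {L G ι : Type*} [LieRing L] [LieAlgebra ℝ L] [Group G] [Fintype ι] {S : CarnotGroup L G}

@[simp] theorem coord_point (R : RationalCoordinates S ι) (x : ι → ℝ) :
    R.coord (R.point x) = x := by
  rw [coord, point, Equiv.symm_apply_apply, LinearEquiv.apply_symm_apply]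

@[simp] theorem point_coord (R : RationalCoordinates S ι) (g : G) : R.point (R.coord g) = g := by
  simp [coord, point]

theorem coord_injective (R : RationalCoordinates S ι) : Function.Injective R.coord :=
  fun g h e => by rw [← R.point_coord g, e, R.point_coord]

theorem weight_pos (R : RationalCoordinates S ι) (j : ι) : 0 < R.weight j := by
  rcases Nat.eq_zero_or_pos (R.weight j) with h | h
  · have := R.basis_mem j
    rw [h, S.layer_zero, Submodule.mem_bot] at this
    exact absurd this (R.basis.ne_zero j)
  · exact h

theorem weight_le_step (R : RationalCoordinates S ι) (j : ι) : R.weight j ≤ S.step := by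
  by_contra h
  have := R.basis_mem j
  rw [S.layer_of_gt _ (not_le.1 h), Submodule.mem_bot] at this
  exact R.basis.ne_zero j this

theorem one_le_step (R : RationalCoordinates S ι) [Nonempty ι] : 1 ≤ S.step :=
  (R.weight_pos (Classical.arbitrary ι)).trans_le (R.weight_le_step _)

@[simp] theorem coord_one (R : RationalCoordinates S ι) : R.coord 1 = 0 := by
  simp only [coord]
  rw [← S.exp_zero, Equiv.symm_apply_apply, map_zero]

theorem coord_inv [Nonempty ι] (R : RationalCoordinates S ι) (g : G) :
    R.coord g⁻¹ = -R.coord g := by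
  simp only [coord]
  obtain ⟨x, rfl⟩ := S.exp.surjective g
  rw [← S.exp_neg R.one_le_step, Equiv.symm_apply_apply, Equiv.symm_apply_apply, map_neg]

/-- The linear map that multiplies the layer `i` by `r ^ i`. -/
noncomputable def dilationMap (R : RationalCoordinates S ι) (r : ℝ) : L →ₗ[ℝ] L :=
  R.basis.constr ℝ fun j => r ^ R.weight j • R.basis j

theorem dilationMap_basis (R : RationalCoordinates S ι) (r : ℝ) (j : ι) :
    R.dilationMap r (R.basis j) = r ^ R.weight j • R.basis j := by
  rw [dilationMap, Module.Basis.constr_basis]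

/-- An element of the layer `i` has no components of other weights: their sum `v` lies both in that
layer and in the span of the others, and the layers are independent. -/
theorem dilationMap_of_mem (R : RationalCoordinates S ι) (r : ℝ) {i : ℕ} {x : L}
    (hx : x ∈ S.layer i) : R.dilationMap r x = r ^ i • x := by
  classical
  have hsum := R.basis.sum_repr x
  rw [← Finset.sum_filter_add_sum_filter_not Finset.univ (fun j => R.weight j = i)] at hsum
  set u := ∑ j with R.weight j = i, R.basis.repr x j • R.basis j with hu
  set v := ∑ j with ¬ R.weight j = i, R.basis.repr x j • R.basis j with hv
  have hui : u ∈ S.layer i := Submodule.sum_mem _ fun j hj => by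
    rw [← (Finset.mem_filter.1 hj).2]
    exact Submodule.smul_mem _ _ (R.basis_mem j)
  have hvi : v ∈ ⨆ (k : ℕ) (_ : k ≠ i), S.layer k := Submodule.sum_mem _ fun j hj => by
    refine Submodule.smul_mem _ _ ?_
    exact Submodule.mem_iSup_of_mem (R.weight j)
      (Submodule.mem_iSup_of_mem (Finset.mem_filter.1 hj).2 (R.basis_mem j))
  have hv0 : v = 0 := by
    have hd := S.isInternal.submodule_iSupIndep i
    refine Submodule.disjoint_def.1 hd v ?_ hvi
    rw [show v = x - u from by rw [← hsum]; abel]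
    exact Submodule.sub_mem _ hx hui
  rw [hv0, add_zero] at hsum
  rw [← hsum, hu, map_sum, Finset.smul_sum]
  refine Finset.sum_congr rfl fun j hj => ?_
  rw [map_smul, dilationMap_basis, (Finset.mem_filter.1 hj).2, smul_comm]

/-- The bracket respects the grading, so on basis vectors the claim is `r ^ (i + j) = r ^ i * r ^
j`. Since `bch` is built from brackets, dilations are therefore group homomorphisms. -/
theorem dilationMap_lie (R : RationalCoordinates S ι) (r : ℝ) (x y : L) :
    R.dilationMap r ⁅x, y⁆ = ⁅R.dilationMap r x, R.dilationMap r y⁆ := by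
  have hx : x ∈ Submodule.span ℝ (Set.range R.basis) := R.basis.mem_span x
  have hy : y ∈ Submodule.span ℝ (Set.range R.basis) := R.basis.mem_span y
  induction hx using Submodule.span_induction with
  | zero => simp
  | add a b _ _ ha hb => simp [ha, hb]
  | smul c a _ ha => simp [ha]
  | mem a ha =>
      obtain ⟨i, rfl⟩ := ha
      induction hy using Submodule.span_induction with
      | zero => simp
      | add a b _ _ ha hb => simp [ha, hb]
      | smul c a _ ha => simp [ha]
      | mem b hb =>
          obtain ⟨j, rfl⟩ := hb
          rw [R.dilationMap_of_mem r (S.lie_mem_layer _ _ (R.basis_mem i) (R.basis_mem j)),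
            dilationMap_basis, dilationMap_basis, smul_lie, lie_smul, smul_smul, pow_add]

theorem coord_dilation (R : RationalCoordinates S ι) (r : ℝ) (g : G) (j : ι) :
    R.coord (R.dilation r g) j = r ^ R.weight j * R.coord g j := by
  simp [dilation]

theorem dilation_exp (R : RationalCoordinates S ι) (r : ℝ) (x : L) :
    R.dilation r (S.exp x) = S.exp (R.dilationMap r x) := by
  apply R.coord_injective
  funext j
  rw [coord_dilation]
  simp only [coord, Equiv.symm_apply_apply]
  conv_rhs => rw [← R.basis.sum_equivFun x]
  simp only [map_sum, map_smul, dilationMap_basis, smul_smul, Module.Basis.equivFun_apply,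
    Finset.sum_apply, Pi.smul_apply, smul_eq_mul]
  classical
  simp only [Module.Basis.repr_self, Finsupp.single_apply]
  simp [mul_comm]

theorem dilation_mul (R : RationalCoordinates S ι) (r : ℝ) (g h : G) :
    R.dilation r (g * h) = R.dilation r g * R.dilation r h := by
  obtain ⟨x, rfl⟩ := S.exp.surjective g
  obtain ⟨y, rfl⟩ := S.exp.surjective h
  rw [S.exp_mul_exp, dilation_exp, dilation_exp, dilation_exp, S.exp_mul_exp,
    bch_map _ (R.dilationMap_lie r)]

theorem dilation_dilation (R : RationalCoordinates S ι) (r s : ℝ) (g : G) :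
    R.dilation r (R.dilation s g) = R.dilation (r * s) g := by
  apply R.coord_injective
  funext j
  simp only [coord_dilation, mul_pow, mul_assoc]

@[simp] theorem dilation_one (R : RationalCoordinates S ι) (g : G) : R.dilation 1 g = g := by
  apply R.coord_injective
  funext j
  simp [coord_dilation]

/-- The dilations with natural factors, as endomorphisms of the group. -/
noncomputable def dilationHom (R : RationalCoordinates S ι) : ℕ →* Monoid.End G where
  toFun n := MonoidHom.mk' (R.dilation n) (R.dilation_mul n)
  map_one' := by
    ext g
    change R.dilation ((1 : ℕ) : ℝ) g = g
    rw [Nat.cast_one, dilation_one]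
  map_mul' m n := by
    ext g
    change R.dilation ((m * n : ℕ) : ℝ) g = R.dilation m (R.dilation n g)
    rw [Nat.cast_mul, dilation_dilation]

@[simp] theorem dilationHom_apply (R : RationalCoordinates S ι) (n : ℕ) (g : G) :
    R.dilationHom n g = R.dilation n g := rfl

theorem dilationHom_bijective (R : RationalCoordinates S ι) {n : ℕ} (hn : n ≠ 0) :
    Function.Bijective (R.dilationHom n) := by
  have h : (n : ℝ) ≠ 0 := Nat.cast_ne_zero.2 hn
  refine Function.bijective_iff_has_inverse.2 ⟨R.dilation (n : ℝ)⁻¹, fun g => ?_, fun g => ?_⟩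
  · simp [dilation_dilation, inv_mul_cancel₀ h]
  · simp [dilation_dilation, mul_inv_cancel₀ h]

theorem coord_mul (R : RationalCoordinates S ι) (g h : G) (j : ι) :
    R.coord (g * h) j = R.coord g j + R.coord h j +
      MvPolynomial.aeval (Sum.elim (fun k => R.coord g k.1) (fun k => R.coord h k.1)) (R.poly j) :=
  R.mul_coord g h j

theorem aeval_poly_congr (R : RationalCoordinates S ι) (j : ι) {x x' y y' : ι → ℝ}
    (hx : ∀ k, R.weight k < R.weight j → x k = x' k)
    (hy : ∀ k, R.weight k < R.weight j → y k = y' k) :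
    MvPolynomial.aeval (Sum.elim (fun k => x k.1) (fun k => y k.1)) (R.poly j) =
      MvPolynomial.aeval (Sum.elim (fun k => x' k.1) (fun k => y' k.1)) (R.poly j) := by
  congr 2
  funext k
  rcases k with k | k
  · exact hx _ k.2
  · exact hy _ k.2

/-- The polynomial of the `j`-th coordinate cannot distinguish `g` from `1`, and `1 * h = h` forces
it to vanish there. This allows lattice arguments to proceed weight by weight. -/
theorem coord_mul_of_lower (R : RationalCoordinates S ι) (g h : G) (j : ι)
    (hg : ∀ k, R.weight k < R.weight j → R.coord g k = 0) :
    R.coord (g * h) j = R.coord g j + R.coord h j := by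
  rw [coord_mul, R.aeval_poly_congr j (x' := R.coord 1) (y' := R.coord h)
    (fun k hk => by simp [hg k hk]) (fun _ _ => rfl)]
  have := R.coord_mul 1 h j
  simp only [one_mul, coord_one, Pi.zero_apply, zero_add, left_eq_add] at this
  simp only [coord_one, Pi.zero_apply, this, add_zero]

theorem exists_int_aeval {σ : Type*} (p : MvPolynomial σ ℤ) (f : σ → ℝ)
    (hf : ∀ i, ∃ m : ℤ, f i = m) : ∃ m : ℤ, MvPolynomial.aeval f p = (m : ℝ) := by
  choose m hm using hf
  refine ⟨MvPolynomial.aeval m p, ?_⟩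
  rw [show f = fun i => algebraMap ℤ ℝ (m i) from funext hm]
  exact MvPolynomial.aeval_algebraMap_apply ℝ m p

/-- The integer lattice as a subgroup. -/
def lattice [Nonempty ι] (R : RationalCoordinates S ι) : Subgroup G where
  carrier := R.integerPoints
  one_mem' j := ⟨0, by simp⟩
  mul_mem' {g h} hg hh j := by
    obtain ⟨a, ha⟩ := hg j
    obtain ⟨b, hb⟩ := hh j
    obtain ⟨c, hc⟩ := exists_int_aeval (R.poly j)
      (Sum.elim (fun k => R.coord g k.1) (fun k => R.coord h k.1))
      (by rintro (k | k); exacts [hg _, hh _])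
    exact ⟨a + b + c, by rw [coord_mul, ha, hb, hc]; push_cast; ring⟩
  inv_mem' {g} hg j := by
    obtain ⟨a, ha⟩ := hg j
    exact ⟨-a, by simp [R.coord_inv, ha]⟩

theorem countable_integerPoints (R : RationalCoordinates S ι) : R.integerPoints.Countable := by
  have : R.integerPoints ⊆ Set.range fun m : ι → ℤ => R.point fun j => (m j : ℝ) := by
    intro g hg
    choose m hm using hg
    exact ⟨m, by simp only [← hm]; exact R.point_coord g⟩
  exact (Set.countable_range _).mono this

theorem dilationHom_mem_lattice [Nonempty ι] (R : RationalCoordinates S ι) (n : ℕ) {g : G}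
    (hg : g ∈ R.lattice) : R.dilationHom n g ∈ R.lattice := fun j => by
  obtain ⟨m, hm⟩ := hg j
  exact ⟨n ^ R.weight j * m, by rw [dilationHom_apply, coord_dilation, hm]; push_cast; rfl⟩

/-- A Bézout relation between `a ^ w` and `b ^ w` recovers each coordinate of weight `w` as an
integer combination of integers. -/
theorem mem_lattice_of_coprime [Nonempty ι] (R : RationalCoordinates S ι) {a b : ℕ}
    (hab : a.Coprime b) {g : G} (ha : R.dilationHom a g ∈ R.lattice)
    (hb : R.dilationHom b g ∈ R.lattice) : g ∈ R.lattice := fun j => by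
  obtain ⟨m, hm⟩ := ha j
  obtain ⟨n, hn⟩ := hb j
  rw [dilationHom_apply, coord_dilation] at hm hn
  have hc : IsCoprime ((a : ℤ) ^ R.weight j) ((b : ℤ) ^ R.weight j) :=
    (Nat.isCoprime_iff_coprime.2 hab).pow
  obtain ⟨u, v, huv⟩ := hc
  have huv' : (u : ℝ) * a ^ R.weight j + v * b ^ R.weight j = 1 := by exact_mod_cast huv
  refine ⟨u * m + v * n, ?_⟩
  push_cast
  rw [← hm, ← hn]
  linear_combination (-R.coord g j) * huv'

/-! ### The homogeneous gauge -/

section Gauge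

variable (R : RationalCoordinates S ι) (lam : ℕ → ℝ)

theorem infNorm_inv [Nonempty ι] (g : G) : R.infNorm lam g⁻¹ = R.infNorm lam g := by
  simp [infNorm, coord_inv]

theorem infNorm_le_iff [Nonempty ι] (hlam : ∀ i, 0 < lam i) {r : ℝ} (hr : 0 ≤ r) (g : G) :
    R.infNorm lam g ≤ r ↔ ∀ j, |R.coord g j| ≤ r ^ R.weight j / lam (R.weight j) := by
  rw [infNorm, ciSup_le_iff (Set.finite_range _).bddAbove]
  refine forall_congr' fun j => ?_
  have hw : (0 : ℝ) < R.weight j := Nat.cast_pos.2 (R.weight_pos j)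
  rw [le_div_iff₀ (hlam _), one_div, Real.rpow_inv_le_iff_of_pos (abs_nonneg _) hr hw,
    Real.rpow_natCast, abs_mul, abs_of_pos (hlam _), mul_comm]

theorem infNorm_dilation [Nonempty ι] {r : ℝ} (hr : 0 ≤ r) (g : G) :
    R.infNorm lam (R.dilation r g) = r * R.infNorm lam g := by
  rw [infNorm, infNorm, Real.mul_iSup_of_nonneg hr]
  congr 1
  funext j
  have hw : (R.weight j : ℝ) ≠ 0 := Nat.cast_ne_zero.2 (R.weight_pos j).ne'
  rw [coord_dilation, mul_left_comm, abs_mul, abs_of_nonneg (pow_nonneg hr _),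
    Real.mul_rpow (pow_nonneg hr _) (abs_nonneg _), one_div,
    Real.pow_rpow_inv_natCast hr (R.weight_pos j).ne']

theorem infNorm_mul_le
    (htri : ∀ x y z : G, R.infDist lam x z ≤ R.infDist lam x y + R.infDist lam y z) (g h : G) :
    R.infNorm lam (g * h) ≤ R.infNorm lam g + R.infNorm lam h := by
  have := htri 1 g (g * h)
  simpa [infDist] using this

end Gauge

end RationalCoordinates

/-! ### Invariance of Lebesgue measure under left translations -/

/-- A map that translates some coordinates by functions of the other ones preserves volume. -/
theorem measurePreserving_shear {ι : Type*} [Fintype ι] (F : ι → Prop) [DecidablePred F]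
    (h : (ι → ℝ) → ι → ℝ) (hm : Measurable h)
    (hdep : ∀ x y : ι → ℝ, (∀ k, F k → x k = y k) → ∀ j, ¬ F j → h x j = h y j) :
    MeasurePreserving (fun (x : ι → ℝ) j => if F j then x j else x j + h x j)
      (volume : Measure (ι → ℝ)) volume := by
  let e := MeasurableEquiv.piEquivPiSubtypeProd (fun _ : ι => ℝ) F
  have he : MeasurePreserving e volume volume :=
    volume_preserving_piEquivPiSubtypeProd (fun _ => ℝ) F
  -- The shift is evaluated with the moving coordinates set to zero; by `hdep` this does not affect
  -- its value.
  let t : ({j // F j} → ℝ) → ({j // ¬ F j} → ℝ) → ({j // ¬ F j} → ℝ) :=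
    fun a y => y + fun j => h (e.symm (a, 0)) j.1
  have ht : Measurable (Function.uncurry t) := by
    refine measurable_snd.add (measurable_pi_lambda (fun p : ({j // F j} → ℝ) × ({j // ¬ F j} → ℝ) =>
      fun j : {j // ¬ F j} => h (e.symm (p.1, 0)) j.1) fun j => ?_)
    exact (measurable_pi_apply _).comp
      (hm.comp (e.symm.measurable.comp (measurable_fst.prodMk measurable_const)))
  have hs : MeasurePreserving (fun p : ({j // F j} → ℝ) × ({j // ¬ F j} → ℝ) => (p.1, t p.1 p.2))
      (volume.prod volume) (volume.prod volume) :=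
    (MeasurePreserving.id volume).skew_product ht
      (ae_of_all _ fun a => map_add_right_eq_self volume _)
  have key := (he.symm e).comp (hs.comp he)
  have hcomp : (fun (x : ι → ℝ) j => if F j then x j else x j + h x j) =
      e.symm ∘ (fun p => (p.1, t p.1 p.2)) ∘ e := by
    funext x j
    by_cases hj : F j
    · simp [hj, e, MeasurableEquiv.piEquivPiSubtypeProd, Equiv.piEquivPiSubtypeProd]
    · simp only [hj, e, t, MeasurableEquiv.piEquivPiSubtypeProd, Equiv.piEquivPiSubtypeProd,
        if_false, Function.comp_apply]
      simp only [MeasurableEquiv.symm_mk, MeasurableEquiv.coe_mk, Equiv.coe_fn_symm_mk,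
        Equiv.coe_fn_mk, hj, dite_false, Pi.add_apply]
      congr 1
      exact hdep _ _ (fun k hk => by simp [hk]) j hj
  rw [hcomp]
  exact key

namespace RationalCoordinates

variable {L G ι : Type*} [LieRing L] [LieAlgebra ℝ L] [Group G] [Fintype ι] {S : CarnotGroup L G}

theorem measurable_coord_mul (R : RationalCoordinates S ι) (g : G) :
    Measurable fun x => R.coord (g * R.point x) := by
  refine measurable_pi_lambda _ fun j => Continuous.measurable ?_
  simp only [coord_mul, coord_point]
  refine ((continuous_const).add (continuous_apply j)).add ?_
  simp only [MvPolynomial.aeval_def, ← MvPolynomial.eval_map]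
  refine (MvPolynomial.continuous_eval _).comp (continuous_pi fun k => ?_)
  rcases k with k | k
  · exact continuous_const
  · exact continuous_apply k.1

theorem coord_mul_sub_congr (R : RationalCoordinates S ι) (g : G) (j : ι) {x y : ι → ℝ}
    (h : ∀ k, R.weight k < R.weight j → x k = y k) :
    R.coord (g * R.point x) j - x j = R.coord (g * R.point y) j - y j := by
  simp only [coord_mul, coord_point]
  rw [R.aeval_poly_congr j (fun _ _ => rfl) h]
  ring

/-- Left translation is a composition of shears, one for each weight, because it changes a
coordinate by a function of lower ones. The weights are treated from the top down (`m` decreases as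
`k` grows), so the shear at weight `m` still sees the original lower coordinates. -/
theorem measurePreserving_coord_mul (R : RationalCoordinates S ι) (g : G) :
    MeasurePreserving (fun x => R.coord (g * R.point x)) (volume : Measure (ι → ℝ)) volume := by
  have key : ∀ k m, m + k = (Finset.univ.sup R.weight) + 1 →
      MeasurePreserving
        (fun (x : ι → ℝ) j => if R.weight j < m then x j else R.coord (g * R.point x) j)
        volume volume := by
    intro k
    induction k with
    | zero =>
        intro m hm
        have : (fun (x : ι → ℝ) j =>
            if R.weight j < m then x j else R.coord (g * R.point x) j) = id := by
          funext x j
          have : R.weight j ≤ Finset.univ.sup R.weight := Finset.le_sup (Finset.mem_univ j)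
          rw [if_pos (by omega), id]
        rw [this]
        exact MeasurePreserving.id _
    | succ k ih =>
        intro m hm
        have h1 := ih (m + 1) (by omega)
        have h2 := measurePreserving_shear (fun j => R.weight j ≠ m)
          (fun x j => if R.weight j = m then R.coord (g * R.point x) j - x j else 0)
          (measurable_pi_lambda _ fun j => by
            split_ifs
            · exact ((measurable_pi_apply j).comp (R.measurable_coord_mul g)).sub
                (measurable_pi_apply j)
            · exact measurable_const)
          (fun x y hxy j hj => by
            have hj' : R.weight j = m := not_not.1 hj
            simp only [hj', if_true]
            exact R.coord_mul_sub_congr g j fun k hk => hxy k (by omega))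
        convert h2.comp h1 using 1
        funext x j
        rcases lt_trichotomy (R.weight j) m with hj | hj | hj
        · simp only [Function.comp_apply, hj, hj.ne, Nat.lt_succ_of_lt hj, if_true, ne_eq,
            not_false_eq_true]
        · simp only [Function.comp_apply, hj, lt_irrefl, if_false, ne_eq, not_true_eq_false,
            if_true, lt_add_one]
          have := R.coord_mul_sub_congr g j (x := fun k => if R.weight k < m + 1 then x k else
            R.coord (g * R.point x) k) (y := x) fun k hk => if_pos (by omega)
          simp only [hj, lt_add_one, if_true] at this
          rw [this]
          ring
        · simp only [Function.comp_apply, hj.ne', not_lt.2 hj.le, show ¬ R.weight j < m + 1 by omega,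
            if_false, if_true, ne_eq, not_false_eq_true]
  simpa using key _ 0 (zero_add _)

/-! ### The unit cube as a fundamental domain for the lattice -/

section FundamentalDomain

variable [Nonempty ι] (R : RationalCoordinates S ι)

/-- The points with coordinates in `[0, 1)`. -/
def unitCube : Set G := {g | ∀ j, R.coord g j ∈ Set.Ico (0 : ℝ) 1}

/-- Integer parts are removed in order of increasing weight: a lattice point supported in weight `m`
leaves the lower coordinates alone and acts on those of weight `m` by addition. Its effect on higher
coordinates is repaired later. -/
theorem exists_lattice_mul_mem (x : G) : ∃ g ∈ R.lattice, g * x ∈ R.unitCube := by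
  have key : ∀ m, ∃ g ∈ R.lattice, ∀ j, R.weight j < m → R.coord (g * x) j ∈ Set.Ico (0 : ℝ) 1 := by
    intro m
    induction m with
    | zero => exact ⟨1, one_mem _, by simp⟩
    | succ m ih =>
        obtain ⟨g, hg, h⟩ := ih
        let u : G := R.point fun j =>
          if R.weight j = m then ((-⌊R.coord (g * x) j⌋ : ℤ) : ℝ) else 0
        have hu : u ∈ R.lattice := fun j => by
          by_cases hj : R.weight j = m
          · exact ⟨-⌊R.coord (g * x) j⌋, by simp [u, hj]⟩
          · exact ⟨0, by simp [u, hj]⟩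
        refine ⟨u * g, mul_mem hu hg, fun j hj => ?_⟩
        rw [mul_assoc, R.coord_mul_of_lower]
        · rcases Nat.lt_succ_iff_lt_or_eq.1 hj with hj | hj
          · simpa [u, hj.ne] using h j hj
          · simp only [u, coord_point, hj, if_true, Int.cast_neg, Set.mem_Ico]
            have h1 := Int.floor_le (R.coord (g * x) j)
            have h2 := Int.lt_floor_add_one (R.coord (g * x) j)
            constructor <;> linarith
        · intro k hk
          simp [u, show R.weight k ≠ m by omega]
  obtain ⟨g, hg, h⟩ := key (Finset.univ.sup R.weight + 1)
  exact ⟨g, hg, fun j => h j (Nat.lt_succ_of_le (Finset.le_sup (Finset.mem_univ j)))⟩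

/-- Once the lower coordinates of `g` vanish, the next one is an integer equal to a difference of
two numbers in `[0, 1)`. -/
theorem eq_one_of_mul_mem {g x : G} (hg : g ∈ R.lattice) (hx : x ∈ R.unitCube)
    (hgx : g * x ∈ R.unitCube) : g = 1 := by
  have key : ∀ m j, R.weight j < m → R.coord g j = 0 := by
    intro m
    induction m with
    | zero => simp
    | succ m ih =>
        intro j hj
        have h := hgx j
        rw [R.coord_mul_of_lower g x j fun k hk => ih k (by omega)] at h
        obtain ⟨n, hn⟩ := hg j
        have hxj := hx j
        rw [hn] at h ⊢
        have h1 : (n : ℝ) < 1 := by linarith [h.2, hxj.1]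
        have h2 : (-1 : ℝ) < n := by linarith [h.1, hxj.2]
        have h1' : n < 1 := by exact_mod_cast h1
        have h2' : -1 < n := by exact_mod_cast h2
        have : n = 0 := by omega
        simp [this]
  apply R.coord_injective
  funext j
  rw [key _ j (Nat.lt_succ_self _), coord_one, Pi.zero_apply]

theorem existsUnique_smul_mem (x : G) : ∃! g : R.lattice, g • x ∈ R.unitCube := by
  obtain ⟨g, hg, h⟩ := R.exists_lattice_mul_mem x
  refine ⟨⟨g, hg⟩, h, ?_⟩
  rintro ⟨g', hg'⟩ h'
  have h'' : g' * x ∈ R.unitCube := h'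
  have := R.eq_one_of_mul_mem (g := g' * g⁻¹) (mul_mem hg' (inv_mem hg)) h
    (by rwa [mul_assoc, inv_mul_cancel_left])
  exact Subtype.ext (mul_inv_eq_one.1 this)

theorem exists_infNorm_le_of_mem_unitCube (lam : ℕ → ℝ) (hlam : ∀ i, 0 < lam i) :
    ∃ c : ℝ, 0 ≤ c ∧ ∀ g ∈ R.unitCube, R.infNorm lam g ≤ c := by
  have h0 : ∀ j ∈ Finset.univ, 0 ≤ lam (R.weight j) := fun j _ => (hlam _).le
  have hc : 0 ≤ ∑ j, lam (R.weight j) := Finset.sum_nonneg h0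
  -- This constant is at least `1` and at least every weight, so its positive powers also dominate
  -- the weights.
  refine ⟨1 + ∑ j, lam (R.weight j), by positivity, fun g hg => ?_⟩
  rw [R.infNorm_le_iff lam hlam (by positivity)]
  intro j
  have h1 : |R.coord g j| ≤ 1 := abs_le.2 ⟨by linarith [(hg j).1], (hg j).2.le⟩
  refine h1.trans ((one_le_div (hlam _)).2 ?_)
  have h2 : lam (R.weight j) ≤ ∑ j, lam (R.weight j) :=
    Finset.single_le_sum h0 (Finset.mem_univ j)
  calc lam (R.weight j) ≤ 1 + ∑ j, lam (R.weight j) := by linarith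
    _ ≤ _ := le_self_pow₀ (by linarith) (R.weight_pos j).ne'

end FundamentalDomain

/-! ### The invariant measure, its scaling and the volume of balls -/

section Measure

variable [MeasurableSpace G] (R : RationalCoordinates S ι) (e : G ≃ᵐ (ι → ℝ))

theorem coord_symm (he : ∀ g, e g = R.coord g) (x : ι → ℝ) : R.coord (e.symm x) = x := by
  rw [← he, MeasurableEquiv.apply_symm_apply]

theorem measurable_mul_left_of_coord (he : ∀ g, e g = R.coord g) (g : G) :
    Measurable fun x : G => g * x := by
  have : (fun x : G => g * x) = e.symm ∘ (fun x => R.coord (g * R.point x)) ∘ e := by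
    funext x
    apply R.coord_injective
    simp only [Function.comp_apply, R.coord_symm e he, he, point_coord]
  rw [this]
  exact e.symm.measurable.comp ((R.measurable_coord_mul g).comp e.measurable)

theorem measurePreserving_mul_left_of_coord (he : ∀ g, e g = R.coord g) (g : G) :
    MeasurePreserving (fun x : G => g * x) (volume.map e.symm) (volume.map e.symm) := by
  have : (fun x : G => g * x) = e.symm ∘ (fun x => R.coord (g * R.point x)) ∘ e := by
    funext x
    apply R.coord_injective
    simp only [Function.comp_apply, R.coord_symm e he, he, point_coord]
  rw [this]
  have h1 : MeasurePreserving e.symm volume (volume.map e.symm) :=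
    e.symm.measurable.measurePreserving _
  exact h1.comp ((R.measurePreserving_coord_mul g).comp (h1.symm e.symm))

theorem measurable_dilation_of_coord (he : ∀ g, e g = R.coord g) (r : ℝ) :
    Measurable (R.dilation r) := by
  have : R.dilation r = e.symm ∘ (fun x j => r ^ R.weight j * x j) ∘ e := by
    funext x
    apply R.coord_injective
    funext j
    simp only [Function.comp_apply, R.coord_symm e he, he, coord_dilation]
  rw [this]
  exact e.symm.measurable.comp (Measurable.comp (by fun_prop) e.measurable)

theorem smul_map_dilation (he : ∀ g, e g = R.coord g) {r : ℝ} (hr : 0 < r) :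
    ENNReal.ofReal (r ^ R.homDim) • (volume.map e.symm).map (R.dilation r) =
      volume.map e.symm := by
  classical
  have hcomp : R.dilation r ∘ e.symm =
      e.symm ∘ Matrix.toLin' (Matrix.diagonal fun j => r ^ R.weight j) := by
    funext x
    apply R.coord_injective
    funext j
    simp only [Function.comp_apply, R.coord_symm e he, coord_dilation,
      Matrix.toLin'_apply, Matrix.mulVec_diagonal]
  have hdet : (Matrix.diagonal fun j => r ^ R.weight j).det = r ^ R.homDim := by
    rw [Matrix.det_diagonal, homDim, Finset.prod_pow_eq_pow_sum]
  have h := Real.smul_map_diagonal_volume_pi (D := fun j => r ^ R.weight j)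
    (by rw [hdet]; positivity)
  rw [hdet, abs_of_pos (by positivity)] at h
  rw [Measure.map_map (R.measurable_dilation_of_coord e he r) e.symm.measurable, hcomp,
    ← Measure.map_map e.symm.measurable
      (LinearMap.continuous_on_pi _).measurable]
  conv_rhs => rw [← h]
  rw [Measure.map_smul]

theorem measurable_infNorm_of_coord [Nonempty ι] (he : ∀ g, e g = R.coord g) (lam : ℕ → ℝ) :
    Measurable (R.infNorm lam) := by
  have : R.infNorm lam = (fun x : ι → ℝ =>
      ⨆ j, |lam (R.weight j) * x j| ^ (1 / (R.weight j : ℝ))) ∘ e := by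
    funext g
    simp [infNorm, he]
  rw [this]
  refine Measurable.comp (Measurable.iSup fun j => ?_) e.measurable
  fun_prop

theorem measure_infNorm_le [Nonempty ι] (he : ∀ g, e g = R.coord g) (lam : ℕ → ℝ)
    (hlam : ∀ i, 0 < lam i) {r : ℝ} (hr : 0 ≤ r) :
    (volume.map e.symm) {g : G | R.infNorm lam g ≤ r} =
      ENNReal.ofReal (R.ballConst lam * r ^ R.homDim) := by
  rw [MeasurableEquiv.map_apply]
  have : e.symm ⁻¹' {g : G | R.infNorm lam g ≤ r} =
      Set.Icc (fun j => -(r ^ R.weight j / lam (R.weight j)))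
        (fun j => r ^ R.weight j / lam (R.weight j)) := by
    ext x
    have h2 := R.coord_symm e he x
    simp only [Set.mem_preimage, Set.mem_ofPred_eq, R.infNorm_le_iff lam hlam hr, h2, Set.mem_Icc,
      abs_le, Pi.le_def, forall_and]
  rw [this, Real.volume_Icc_pi, ← ENNReal.ofReal_prod_of_nonneg]
  · congr 1
    rw [ballConst, homDim, ← Finset.prod_pow_eq_pow_sum, ← Finset.card_univ, ← Finset.prod_const,
      ← Finset.prod_mul_distrib, ← Finset.prod_mul_distrib]
    refine Finset.prod_congr rfl fun j _ => ?_
    ring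
  · intro j _
    have : 0 ≤ r ^ R.weight j / lam (R.weight j) := div_nonneg (pow_nonneg hr _) (hlam _).le
    linarith

theorem measurableSet_unitCube (he : ∀ g, e g = R.coord g) :
    MeasurableSet R.unitCube := by
  have : R.unitCube = e ⁻¹' Set.univ.pi fun _ => Set.Ico (0 : ℝ) 1 := by
    ext g
    simp [unitCube, he]
  rw [this]
  exact e.measurable (MeasurableSet.univ_pi fun _ => measurableSet_Ico)

theorem measure_unitCube (he : ∀ g, e g = R.coord g) :
    (volume.map e.symm) R.unitCube = 1 := by
  rw [MeasurableEquiv.map_apply]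
  have : e.symm ⁻¹' R.unitCube = Set.univ.pi fun _ => Set.Ico (0 : ℝ) 1 := by
    ext x
    have h2 := R.coord_symm e he x
    simp [unitCube, h2]
  rw [this, volume_pi_pi]
  simp

end Measure

end RationalCoordinates

/-! ### Lattice points in small balls: first and second moments -/

/-- A lattice in a group with a left-invariant measure, together with a homogeneous gauge and a
multiplicative family of dilations that map the lattice into itself. -/
structure DilatedLattice (G : Type*) [Group G] [MeasurableSpace G] (μ : Measure G) where
  lattice : Subgroup G
  countable_lattice : Countable lattice
  domain : Set G
  existsUnique_mul_mem : ∀ g : G, ∃! γ : lattice, (γ : G) * g ∈ domain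
  measurableSet_domain : MeasurableSet domain
  measure_domain : μ domain = 1
  dil : ℕ →* Monoid.End G
  measurable_dil : ∀ n, Measurable (dil n)
  dil_bijective : ∀ n, n ≠ 0 → Function.Bijective (dil n)
  dil_mem : ∀ n, ∀ g ∈ lattice, dil n g ∈ lattice
  mem_of_coprime : ∀ a b : ℕ, a.Coprime b → ∀ g, dil a g ∈ lattice → dil b g ∈ lattice →
    g ∈ lattice
  dim : ℕ
  smul_map_dil : ∀ n : ℕ, n ≠ 0 → (n : ℝ≥0∞) ^ dim • μ.map (dil n) = μ
  gauge : G → ℝ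
  measurable_gauge : Measurable gauge
  gauge_inv : ∀ g, gauge g⁻¹ = gauge g
  gauge_mul_le : ∀ g h, gauge (g * h) ≤ gauge g + gauge h
  gauge_dil : ∀ (n : ℕ) g, gauge (dil n g) = n * gauge g
  vol : ℝ
  vol_nonneg : 0 ≤ vol
  measure_gauge_le : ∀ r : ℝ, 0 ≤ r → μ {g | gauge g ≤ r} = ENNReal.ofReal (vol * r ^ dim)
  diam : ℝ
  diam_nonneg : 0 ≤ diam
  gauge_le_diam : ∀ g ∈ domain, gauge g ≤ diam

namespace DilatedLattice

variable {G : Type*} [Group G] [MeasurableSpace G] {μ : Measure G} (A : DilatedLattice G μ)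

instance : Countable A.lattice := A.countable_lattice

theorem isFundamentalDomain : IsFundamentalDomain A.lattice A.domain μ :=
  .mk' A.measurableSet_domain.nullMeasurableSet A.existsUnique_mul_mem

theorem tsum_indicator_domain (g : G) :
    ∑' γ : A.lattice, A.domain.indicator (1 : G → ℝ≥0∞) (γ * g) = 1 := by
  obtain ⟨γ, hγ, huniq⟩ := A.existsUnique_mul_mem g
  rw [tsum_eq_single γ fun η hη => Set.indicator_of_notMem (fun h => hη (huniq η h)) _,
    Set.indicator_of_mem hγ, Pi.one_apply]

/-- The indicator function of the closed gauge ball of radius `r`. -/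
noncomputable def ball (r : ℝ) : G → ℝ≥0∞ := {g | A.gauge g ≤ r}.indicator 1

theorem measurableSet_ball (r : ℝ) : MeasurableSet {g | A.gauge g ≤ r} :=
  A.measurable_gauge measurableSet_Iic

theorem measurable_ball (r : ℝ) : Measurable (A.ball r) :=
  measurable_one.indicator (A.measurableSet_ball r)

theorem lintegral_ball {r : ℝ} (hr : 0 ≤ r) :
    ∫⁻ g, A.ball r g ∂μ = ENNReal.ofReal (A.vol * r ^ A.dim) := by
  rw [← A.measure_gauge_le r hr, ball, lintegral_indicator_one (A.measurableSet_ball r)]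

theorem ball_le_ball {r s : ℝ} {g h : G} (H : A.gauge g ≤ r → A.gauge h ≤ s) :
    A.ball r g ≤ A.ball s h := by
  by_cases hg : A.gauge g ≤ r
  · rw [ball, ball, Set.indicator_of_mem (show g ∈ {g | A.gauge g ≤ r} from hg),
      Set.indicator_of_mem (show h ∈ {g | A.gauge g ≤ s} from H hg)]
    rfl
  · rw [ball, Set.indicator_of_notMem (show g ∉ {g | A.gauge g ≤ r} from hg)]
    exact zero_le

theorem ball_eq_ball {r s : ℝ} {g h : G} (H : A.gauge g ≤ r ↔ A.gauge h ≤ s) :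
    A.ball r g = A.ball s h :=
  le_antisymm (A.ball_le_ball H.1) (A.ball_le_ball H.2)

/-- The number of translates of `g` by lattice points in the gauge ball of radius `r`. -/
noncomputable def count (r : ℝ) (g : G) : ℝ≥0∞ := ∑' γ : A.lattice, A.ball r (γ * g)

theorem count_mul_left (r : ℝ) (γ : A.lattice) (g : G) : A.count r (γ * g) = A.count r g := by
  unfold count
  rw [← (Equiv.mulRight γ).tsum_eq fun η : A.lattice => A.ball r (η * g)]
  simp [mul_assoc]

/-- The restriction of a dilation to the lattice. -/
def dilLattice (n : ℕ) : A.lattice →* A.lattice :=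
  ((A.dil n : G →* G).comp A.lattice.subtype).codRestrict A.lattice fun g => A.dil_mem n g g.2

@[simp] theorem coe_dilLattice (n : ℕ) (g : A.lattice) : (A.dilLattice n g : G) = A.dil n g := rfl

theorem dilLattice_injective {n : ℕ} (hn : n ≠ 0) : Function.Injective (A.dilLattice n) :=
  fun _ _ e => Subtype.ext ((A.dil_bijective n hn).1 (congrArg Subtype.val e))

/-- Representatives of the left cosets of `δ_n Γ` split a sum over `Γ` into sums over `t δ_n(η)`.
Their number is not needed here. -/
theorem exists_transversal {n : ℕ} (hn : n ≠ 0) :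
    ∃ T : Set A.lattice, Function.Bijective fun p : T × A.lattice => p.1 * A.dilLattice n p.2 := by
  obtain ⟨T, hT, -⟩ := (A.dilLattice n).range.exists_isComplement_left 1
  refine ⟨T, ?_⟩
  let e : A.lattice ≃ (A.dilLattice n).range :=
    (MonoidHom.ofInjective (A.dilLattice_injective hn)).toEquiv
  exact Function.Bijective.comp hT ((Equiv.refl T).prodCongr e).bijective

theorem lintegral_dil {f : G → ℝ≥0∞} (hf : Measurable f) {n : ℕ} (hn : n ≠ 0) :
    ∫⁻ g, f (A.dil n g) ∂μ = ((n : ℝ≥0∞) ^ A.dim)⁻¹ * ∫⁻ g, f g ∂μ := by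
  have h0 : (n : ℝ≥0∞) ^ A.dim ≠ 0 := pow_ne_zero _ (Nat.cast_ne_zero.2 hn)
  have h1 : (n : ℝ≥0∞) ^ A.dim ≠ ∞ := ENNReal.pow_ne_top (ENNReal.natCast_ne_top n)
  have h2 := congrArg (fun ν => ∫⁻ g, f g ∂ν) (A.smul_map_dil n hn)
  simp only [lintegral_smul_measure, smul_eq_mul, lintegral_map hf (A.measurable_dil n)] at h2
  rw [← h2, ← mul_assoc, ENNReal.inv_mul_cancel h0 h1, one_mul]

/-- After applying `δ_a`, all points counted on the left come from lattice translates `φ p` of a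
single point `δ_a δ_b g`. Coprimality makes these translates distinct, so one count at radius `a *
r` bounds the whole sum. -/
theorem tsum_count_le {a b : ℕ} (ha : a ≠ 0) (hab : a.Coprime b) {T : Set A.lattice}
    (hT : Function.Bijective fun p : T × A.lattice => p.1 * A.dilLattice a p.2)
    (s : T → G) (hs : ∀ t : T, A.dil a (s t) = (t : A.lattice)) (r : ℝ) (g : G) :
    ∑' t : T, A.count r (A.dil b ((s t)⁻¹ * g)) ≤ A.count (a * r) (A.dil a (A.dil b g)) := by
  have hcomm : ∀ x, A.dil a (A.dil b x) = A.dil b (A.dil a x) := fun x => by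
    have : A.dil a * A.dil b = A.dil b * A.dil a := by rw [← map_mul, ← map_mul, mul_comm]
    exact DFunLike.congr_fun this x
  have ha' : (0 : ℝ) < a := Nat.cast_pos.2 (Nat.pos_of_ne_zero ha)
  unfold count
  rw [← ENNReal.tsum_prod' (f := fun p : T × A.lattice =>
    A.ball r (p.2 * A.dil b ((s p.1)⁻¹ * g)))]
  let φ : T × A.lattice → A.lattice :=
    fun p => A.dilLattice a p.2 * (A.dilLattice b (p.1 : A.lattice))⁻¹
  have hφ : Function.Injective φ := by
    rintro ⟨t, γ⟩ ⟨t', γ'⟩ h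
    have h1 : A.dilLattice a (γ'⁻¹ * γ) = A.dilLattice b ((t' : A.lattice)⁻¹ * t) := by
      simp only [φ] at h
      rw [map_mul, map_mul, map_inv, map_inv, inv_mul_eq_iff_eq_mul, ← mul_assoc, ← h]
      group
    -- If two translates coincide, both `δ_a x` and `δ_b x` are lattice points, hence so is `x`;
    -- thus `t` and `t'` represent the same coset.
    obtain ⟨x, hx⟩ := (A.dil_bijective a ha).2 ((t' : A.lattice)⁻¹ * t : A.lattice)
    have h2 : A.dil b x = (γ'⁻¹ * γ : A.lattice) := by
      apply (A.dil_bijective a ha).1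
      rw [hcomm, hx]
      exact (congrArg Subtype.val h1).symm
    have h3 : x ∈ A.lattice := A.mem_of_coprime a b hab x
      (hx ▸ Subtype.property _) (h2 ▸ Subtype.property _)
    have h4 : (t : A.lattice) * A.dilLattice a 1 = (t' : A.lattice) * A.dilLattice a ⟨x, h3⟩ := by
      rw [map_one, mul_one, ← inv_mul_eq_iff_eq_mul]
      exact Subtype.ext hx.symm
    have h5 : t = t' := congrArg Prod.fst (hT.1 (a₁ := (t, 1)) (a₂ := (t', ⟨x, h3⟩)) h4)
    subst h5
    rw [inv_mul_cancel, map_one, ← map_one (A.dilLattice a)] at h1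
    have := A.dilLattice_injective ha h1
    rw [inv_mul_eq_one] at this
    rw [this]
  refine le_trans (ENNReal.tsum_le_tsum fun p => ?_) (ENNReal.tsum_comp_le_tsum_of_injective hφ
    fun γ : A.lattice => A.ball (a * r) (γ * A.dil a (A.dil b g)))
  refine A.ball_le_ball fun h => ?_
  have : (φ p : G) * A.dil a (A.dil b g) = A.dil a (p.2 * A.dil b ((s p.1)⁻¹ * g)) := by
    simp only [φ, Subgroup.coe_mul, Subgroup.coe_inv, coe_dilLattice, map_mul, map_inv, hcomm,
      hs, mul_assoc]
  rw [this, A.gauge_dil]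
  exact mul_le_mul_of_nonneg_left h ha'.le

variable [MeasurableConstSMul G G]

theorem measurable_const_mul' (g : G) : Measurable fun x : G => g * x :=
  measurable_const_smul g

theorem measurable_count (r : ℝ) : Measurable (A.count r) :=
  Measurable.tsum fun _ => (A.measurable_ball r).comp (measurable_const_mul' _)

variable [SMulInvariantMeasure G G μ]

theorem lintegral_mul_left (f : G → ℝ≥0∞) (g : G) : ∫⁻ x, f (g * x) ∂μ = ∫⁻ x, f x ∂μ :=
  (measurePreserving_smul g μ).lintegral_comp_emb (measurableEmbedding_const_smul g) f

theorem lintegral_eq_tsum (f : G → ℝ≥0∞) :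
    ∫⁻ x, f x ∂μ = ∑' γ : A.lattice, ∫⁻ x in A.domain, f (γ * x) ∂μ :=
  A.isFundamentalDomain.lintegral_eq_tsum'' f

theorem lintegral_eq_tsum_inv (f : G → ℝ≥0∞) :
    ∫⁻ x, f x ∂μ = ∑' γ : A.lattice, ∫⁻ x in A.domain, f ((γ : G)⁻¹ * x) ∂μ :=
  A.isFundamentalDomain.lintegral_eq_tsum' f

theorem setLIntegral_count {r : ℝ} (hr : 0 ≤ r) :
    ∫⁻ g in A.domain, A.count r g ∂μ = ENNReal.ofReal (A.vol * r ^ A.dim) := by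
  rw [← A.lintegral_ball hr, A.lintegral_eq_tsum]
  exact lintegral_tsum fun _ =>
    ((A.measurable_ball r).comp (measurable_const_mul' _)).aemeasurable

/-- Packing: each counted `γ` gives a translate `γ⁻¹ • domain` inside the ball of radius `r + diam`
around `g`; these translates have measure one and do not overlap. -/
theorem count_le {r : ℝ} (hr : 0 ≤ r) (g : G) :
    A.count r g ≤ ENNReal.ofReal (A.vol * (r + A.diam) ^ A.dim) := by
  rw [← A.lintegral_ball (add_nonneg hr A.diam_nonneg),
    ← lintegral_mul_left (A.ball (r + A.diam)) g⁻¹, A.lintegral_eq_tsum_inv]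
  refine ENNReal.tsum_le_tsum fun γ => ?_
  calc A.ball r (γ * g) = ∫⁻ x in A.domain, A.ball r (γ * g) ∂μ := by
        rw [lintegral_const, Measure.restrict_apply_univ, A.measure_domain, mul_one]
    _ ≤ _ := by
        refine setLIntegral_mono' A.measurableSet_domain fun x hx => A.ball_le_ball fun h => ?_
        calc A.gauge (g⁻¹ * ((γ : G)⁻¹ * x)) = A.gauge ((γ * g)⁻¹ * x) := by
              rw [mul_inv_rev, mul_assoc]
          _ ≤ A.gauge (γ * g)⁻¹ + A.gauge x := A.gauge_mul_le _ _
          _ ≤ r + A.diam := by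
              rw [A.gauge_inv]
              exact add_le_add h (A.gauge_le_diam x hx)

/-- Unfolding: with `γ = t δ_n(η)` and `δ_n(η) δ_n(g) = δ_n(η g)`, the sum over `η` turns the
integral over the domain into one over `G`, as `k` is invariant. -/
theorem setLIntegral_mul_tsum {n : ℕ} {T : Set A.lattice}
    (hT : Function.Bijective fun p : T × A.lattice => p.1 * A.dilLattice n p.2)
    {h k : G → ℝ≥0∞} (hh : Measurable h) (hk : Measurable k)
    (hinv : ∀ (γ : A.lattice) g, k (γ * g) = k g) :
    ∫⁻ g in A.domain, k g * ∑' γ : A.lattice, h (γ * A.dil n g) ∂μ =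
      ∑' t : T, ∫⁻ g, k g * h ((t : A.lattice) * A.dil n g) ∂μ := by
  have hm : ∀ (t : G), Measurable fun g => h (t * A.dil n g) := fun t =>
    hh.comp ((measurable_const_mul' _).comp (A.measurable_dil n))
  have h1 : ∀ g, k g * ∑' γ : A.lattice, h (γ * A.dil n g) =
      ∑' (t : T) (η : A.lattice), k (η * g) * h ((t : A.lattice) * A.dil n (η * g)) := by
    intro g
    rw [← (Equiv.ofBijective _ hT).tsum_eq, ENNReal.tsum_prod', ← ENNReal.tsum_mul_left]
    refine tsum_congr fun t => ?_
    rw [← ENNReal.tsum_mul_left]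
    refine tsum_congr fun η => ?_
    simp [hinv, mul_assoc]
  have hm' : ∀ (t : G) (η : A.lattice), Measurable fun g => k (η * g) * h (t * A.dil n (η * g)) :=
    fun t η => (hk.mul (hm t)).comp (measurable_const_mul' (η : G))
  simp_rw [h1]
  rw [lintegral_tsum fun t : T => (Measurable.tsum fun η =>
    hm' (t : A.lattice) η).aemeasurable]
  refine tsum_congr fun t => ?_
  rw [lintegral_tsum fun η => (hm' (t : A.lattice) η).aemeasurable, A.lintegral_eq_tsum]

/-- Dilations preserve the measure of `Γ\G`. Unfolding against the indicator of the domain, whose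
translates sum to `1`, gives the identity up to a factor independent of `k`. -/
theorem setLIntegral_comp_dil {k : G → ℝ≥0∞} (hk : Measurable k)
    (hinv : ∀ (γ : A.lattice) g, k (γ * g) = k g) {n : ℕ} (hn : n ≠ 0) :
    ∫⁻ g in A.domain, k (A.dil n g) ∂μ = ∫⁻ g in A.domain, k g ∂μ := by
  obtain ⟨T, hT⟩ := A.exists_transversal hn
  have key : ∀ k : G → ℝ≥0∞, Measurable k → (∀ (γ : A.lattice) g, k (γ * g) = k g) →
      ∫⁻ g in A.domain, k (A.dil n g) ∂μ =
        (∑' _ : T, ((n : ℝ≥0∞) ^ A.dim)⁻¹) * ∫⁻ g in A.domain, k g ∂μ := by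
    intro k hk hinv
    have h1 := A.setLIntegral_mul_tsum hT (measurable_one.indicator A.measurableSet_domain)
      (hk.comp (A.measurable_dil n)) (fun γ g => by
        rw [Function.comp_apply, map_mul]
        exact hinv (A.dilLattice n γ) _)
    simp only [A.tsum_indicator_domain, mul_one, Function.comp_apply] at h1
    rw [h1, ← ENNReal.tsum_mul_right]
    refine tsum_congr fun t => ?_
    have hm : Measurable fun g : G => k g * A.domain.indicator 1 ((t : A.lattice) * g) :=
      hk.mul ((measurable_one.indicator A.measurableSet_domain).comp (measurable_const_mul' _))
    rw [A.lintegral_dil hm hn]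
    congr 1
    rw [← lintegral_mul_left _ ((t : A.lattice) : G)⁻¹,
      ← lintegral_indicator A.measurableSet_domain]
    refine lintegral_congr fun g => ?_
    have := hinv (t : A.lattice)⁻¹ g
    rw [Subgroup.coe_inv] at this
    rw [this, mul_inv_cancel_left]
    by_cases hg : g ∈ A.domain <;> simp [hg]
  -- The case `k = 1` shows that the factor is `1`, without computing the index of `δ_n Γ`.
  have h1 := key 1 measurable_one fun _ _ => rfl
  simp only [Pi.one_apply, lintegral_const, Measure.restrict_apply_univ, A.measure_domain,
    mul_one] at h1
  rw [key k hk hinv, ← h1, one_mul]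

/-- Unfolding the first count and translating by `s t`, where `δ_a (s t) = t`, moves every term to
the same ball of radius `r / a`. The translated second counts together are bounded by packing at
radius `a * r'`. -/
theorem setLIntegral_count_mul_count_of_coprime {a b : ℕ} (ha : a ≠ 0)
    (hab : a.Coprime b) {r r' : ℝ} (hr : 0 ≤ r) (hr' : 0 ≤ r') :
    ∫⁻ g in A.domain, A.count r (A.dil a g) * A.count r' (A.dil b g) ∂μ ≤
      ENNReal.ofReal (A.vol * (r / a) ^ A.dim * (A.vol * (a * r' + A.diam) ^ A.dim)) := by
  obtain ⟨T, hT⟩ := A.exists_transversal ha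
  choose s hs using fun t : T => (A.dil_bijective a ha).2 (t : A.lattice)
  have ha' : (0 : ℝ) < a := Nat.cast_pos.2 (Nat.pos_of_ne_zero ha)
  have hm : Measurable fun g => A.count r' (A.dil b g) :=
    (A.measurable_count r').comp (A.measurable_dil b)
  have h1 := A.setLIntegral_mul_tsum hT (A.measurable_ball r) hm (fun γ g => by
    rw [map_mul]
    exact A.count_mul_left r' (A.dilLattice b γ) _)
  calc _ = ∫⁻ g in A.domain, A.count r' (A.dil b g) * A.count r (A.dil a g) ∂μ := by
        simp_rw [mul_comm]
    _ = ∑' t : T, ∫⁻ g, A.count r' (A.dil b g) * A.ball r ((t : A.lattice) * A.dil a g) ∂μ := h1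
    _ = ∑' t : T, ∫⁻ g, A.count r' (A.dil b ((s t)⁻¹ * g)) * A.ball (r / a) g ∂μ := by
        refine tsum_congr fun t => ?_
        rw [← lintegral_mul_left _ (s t)⁻¹]
        refine lintegral_congr fun g => ?_
        congr 1
        refine A.ball_eq_ball ?_
        rw [← hs t, ← map_mul, mul_inv_cancel_left, A.gauge_dil, le_div_iff₀ ha', mul_comm]
    _ = ∫⁻ g, ∑' t : T, A.count r' (A.dil b ((s t)⁻¹ * g)) * A.ball (r / a) g ∂μ :=
        (lintegral_tsum fun t => ((hm.comp (measurable_const_mul' _)).mul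
          (A.measurable_ball _)).aemeasurable).symm
    _ ≤ ∫⁻ g, ENNReal.ofReal (A.vol * (a * r' + A.diam) ^ A.dim) * A.ball (r / a) g ∂μ := by
        refine lintegral_mono fun g => ?_
        rw [ENNReal.tsum_mul_right]
        gcongr
        exact (A.tsum_count_le ha hab hT s hs r' g).trans
          (A.count_le (mul_nonneg ha'.le hr') _)
    _ = _ := by
        rw [lintegral_const_mul _ (A.measurable_ball _), A.lintegral_ball (div_nonneg hr ha'.le),
          ← ENNReal.ofReal_mul, mul_comm]
        exact mul_nonneg A.vol_nonneg
          (pow_nonneg (add_nonneg (mul_nonneg ha'.le hr') A.diam_nonneg) _)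

/-- The common factor `d` is removed by invariance under `δ_d`. Without `diam / a` the bound would
be exactly the product of the two means. -/
theorem setLIntegral_count_mul_count {d a b : ℕ} (hd : d ≠ 0) (ha : a ≠ 0)
    (hab : a.Coprime b) {r r' : ℝ} (hr : 0 ≤ r) (hr' : 0 ≤ r') :
    ∫⁻ g in A.domain, A.count r (A.dil (d * a) g) * A.count r' (A.dil (d * b) g) ∂μ ≤
      ENNReal.ofReal (A.vol ^ 2 * r ^ A.dim * (r' + A.diam / a) ^ A.dim) := by
  have hdil : ∀ n g, A.dil (d * n) g = A.dil n (A.dil d g) := fun n g => by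
    rw [mul_comm, map_mul]
    rfl
  simp_rw [hdil]
  rw [A.setLIntegral_comp_dil (k := fun g => A.count r (A.dil a g) * A.count r' (A.dil b g))
    (((A.measurable_count r).comp (A.measurable_dil a)).mul
      ((A.measurable_count r').comp (A.measurable_dil b))) _ hd]
  · refine (A.setLIntegral_count_mul_count_of_coprime ha hab hr hr').trans_eq ?_
    have ha' : (a : ℝ) ≠ 0 := Nat.cast_ne_zero.2 ha
    congr 1
    rw [show (a : ℝ) * r' + A.diam = a * (r' + A.diam / a) by field_simp, mul_pow, div_pow]
    field_simp
  · intro γ g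
    rw [map_mul, map_mul]
    exact congrArg₂ _ (A.count_mul_left r (A.dilLattice a γ) _)
      (A.count_mul_left r' (A.dilLattice b γ) _)

end DilatedLattice

/-! ### Divisor and gcd sums -/

theorem Nat.card_divisors_le_two_mul_sqrt (n : ℕ) : n.divisors.card ≤ 2 * n.sqrt := by
  rw [← Finset.card_filter_add_card_filter_not (fun d => d ≤ n.sqrt), two_mul]
  refine add_le_add ?_ ?_
  · calc _ ≤ (Finset.Icc 1 n.sqrt).card := Finset.card_le_card fun d hd => by
          rw [Finset.mem_filter] at hd
          exact Finset.mem_Icc.2 ⟨Nat.pos_of_mem_divisors hd.1, hd.2⟩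
      _ = _ := by simp
  · calc _ ≤ (Finset.Icc 1 n.sqrt).card := by
          refine Finset.card_le_card_of_injOn (fun d => n / d) (fun d hd => ?_) ?_
          · simp only [Finset.coe_filter, Set.mem_ofPred_eq, not_le] at hd
            have hdvd := Nat.dvd_of_mem_divisors hd.1
            have hpos := Nat.pos_of_mem_divisors hd.1
            have hn : n ≠ 0 := (Nat.mem_divisors.1 hd.1).2
            refine Finset.mem_coe.2 (Finset.mem_Icc.2
              ⟨Nat.div_pos (Nat.le_of_dvd (Nat.pos_of_ne_zero hn) hdvd) hpos, ?_⟩)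
            have h1 : n < (n.sqrt + 1) * d :=
              (Nat.lt_succ_sqrt n).trans_le (Nat.mul_le_mul_left _ hd.2)
            exact Nat.lt_succ_iff.1 ((Nat.div_lt_iff_lt_mul hpos).2 h1)
          · intro d hd d' hd' h
            simp only [Finset.coe_filter, Set.mem_ofPred_eq] at hd hd'
            have hn : n ≠ 0 := (Nat.mem_divisors.1 hd.1).2
            have h1 := Nat.div_div_self (Nat.dvd_of_mem_divisors hd.1) hn
            have h2 := Nat.div_div_self (Nat.dvd_of_mem_divisors hd'.1) hn
            simp only at h
            rw [← h1, h, h2]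
      _ = _ := by simp

theorem sum_Icc_inv_pow_le {k : ℕ} (hk : k ≠ 0) (N : ℕ) {t : ℕ} (ht : 1 ≤ t) :
    ∑ a ∈ Finset.Icc k N, ((a : ℝ) ^ (t + 1))⁻¹ ≤ 2 / (k : ℝ) ^ t := by
  have hk' : (0 : ℝ) < k := Nat.cast_pos.2 (Nat.pos_of_ne_zero hk)
  obtain ⟨t, rfl⟩ := Nat.exists_eq_add_of_le ht
  have h1 : ∑ a ∈ Finset.Icc k N, ((a : ℝ) ^ 2)⁻¹ ≤ 2 / k := by
    have := sum_Ioo_inv_sq_le (α := ℝ) (k - 1) (N + 1)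
    rw [Nat.cast_sub (Nat.pos_of_ne_zero hk), Nat.cast_one, sub_add_cancel] at this
    have e : Finset.Icc k N = Finset.Ioo (k - 1) (N + 1) := by
      ext a
      simp only [Finset.mem_Icc, Finset.mem_Ioo]
      omega
    rwa [e]
  calc ∑ a ∈ Finset.Icc k N, ((a : ℝ) ^ (1 + t + 1))⁻¹
      ≤ ∑ a ∈ Finset.Icc k N, ((k : ℝ) ^ t)⁻¹ * ((a : ℝ) ^ 2)⁻¹ := by
        refine Finset.sum_le_sum fun a ha => ?_
        have hka : (k : ℝ) ≤ a := Nat.cast_le.2 (Finset.mem_Icc.1 ha).1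
        have ha' : (0 : ℝ) < a := hk'.trans_le hka
        rw [show 1 + t + 1 = t + 2 by ring, pow_add, mul_inv]
        gcongr
    _ ≤ ((k : ℝ) ^ t)⁻¹ * (2 / k) := by
        rw [← Finset.mul_sum]
        gcongr
    _ = _ := by
        rw [pow_add]
        field_simp

/-- Sorting by `f = gcd(q, m)` and writing `q = f a` leaves a tail `a ≥ m / f` of a convergent
series, the coprimality condition being dropped. The substitution `f ↦ m / f` puts the result in
this form. -/
theorem sum_Icc_gcd_pow_div_le {m : ℕ} (hm : m ≠ 0) (N : ℕ) {t : ℕ} (ht : 1 ≤ t) :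
    ∑ q ∈ Finset.Icc m N, ((q.gcd m : ℝ)) ^ t / (q : ℝ) ^ (t + 1) ≤
      2 / m * ∑ f ∈ m.divisors, ((f : ℝ) ^ (t - 1))⁻¹ := by
  have hm' : (0 : ℝ) < m := Nat.cast_pos.2 (Nat.pos_of_ne_zero hm)
  calc ∑ q ∈ Finset.Icc m N, ((q.gcd m : ℝ)) ^ t / (q : ℝ) ^ (t + 1)
      = ∑ f ∈ m.divisors, ∑ q ∈ Finset.Icc m N with q.gcd m = f,
          ((q.gcd m : ℝ)) ^ t / (q : ℝ) ^ (t + 1) :=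
        (Finset.sum_fiberwise_of_maps_to (fun q _ =>
          Nat.mem_divisors.2 ⟨Nat.gcd_dvd_right q m, hm⟩) _).symm
    _ ≤ ∑ f ∈ m.divisors, ∑ a ∈ Finset.Icc (m / f) N, ((f : ℝ))⁻¹ * ((a : ℝ) ^ (t + 1))⁻¹ := by
        refine Finset.sum_le_sum fun f hf => ?_
        have hf0 := Nat.pos_of_mem_divisors hf
        have hf' : (0 : ℝ) < f := Nat.cast_pos.2 hf0
        set F := {q ∈ Finset.Icc m N | q.gcd m = f} with hF
        have hdvd : ∀ q ∈ F, f ∣ q := fun q hq => by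
          rw [← (Finset.mem_filter.1 hq).2]
          exact Nat.gcd_dvd_left q m
        have hinj : Set.InjOn (fun q => q / f) F := fun q hq q' hq' h => by
          rw [← Nat.div_mul_cancel (hdvd q hq), ← Nat.div_mul_cancel (hdvd q' hq')]
          exact congrArg (· * f) h
        calc ∑ q ∈ F, ((q.gcd m : ℝ)) ^ t / (q : ℝ) ^ (t + 1)
            = ∑ q ∈ F, ((f : ℝ))⁻¹ * (((q / f : ℕ) : ℝ) ^ (t + 1))⁻¹ := by
              refine Finset.sum_congr rfl fun q hq => ?_
              have hq0 : (q : ℝ) ≠ 0 := Nat.cast_ne_zero.2 (by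
                have := (Finset.mem_Icc.1 (Finset.mem_filter.1 hq).1).1
                omega)
              rw [(Finset.mem_filter.1 hq).2, Nat.cast_div (hdvd q hq) hf'.ne', div_pow, inv_div,
                pow_succ (f : ℝ)]
              field_simp
          _ = ∑ a ∈ F.image (fun q => q / f), ((f : ℝ))⁻¹ * ((a : ℝ) ^ (t + 1))⁻¹ :=
              (Finset.sum_image (f := fun a : ℕ => (f : ℝ)⁻¹ * ((a : ℝ) ^ (t + 1))⁻¹) hinj).symm
          _ ≤ _ := by
              refine Finset.sum_le_sum_of_subset_of_nonneg (fun a ha => ?_)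
                fun _ _ _ => by positivity
              obtain ⟨q, hq, rfl⟩ := Finset.mem_image.1 ha
              have := Finset.mem_Icc.1 (Finset.mem_filter.1 hq).1
              exact Finset.mem_Icc.2 ⟨Nat.div_le_div_right this.1,
                (Nat.div_le_self q f).trans this.2⟩
    _ ≤ ∑ f ∈ m.divisors, ((f : ℝ))⁻¹ * (2 / ((m / f : ℕ) : ℝ) ^ t) := by
        refine Finset.sum_le_sum fun f hf => ?_
        rw [← Finset.mul_sum]
        gcongr
        refine sum_Icc_inv_pow_le ?_ N ht
        exact (Nat.div_pos (Nat.divisor_le hf) (Nat.pos_of_mem_divisors hf)).ne'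
    _ = ∑ f ∈ m.divisors, (((m / f : ℕ) : ℝ))⁻¹ * (2 / (f : ℝ) ^ t) := by
        rw [← Nat.sum_div_divisors]
        refine Finset.sum_congr rfl fun f hf => ?_
        rw [Nat.div_div_self (Nat.dvd_of_mem_divisors hf) hm]
    _ = _ := by
        rw [Finset.mul_sum]
        refine Finset.sum_congr rfl fun f hf => ?_
        have hf' : (f : ℝ) ≠ 0 := Nat.cast_ne_zero.2 (Nat.pos_of_mem_divisors hf).ne'
        obtain ⟨t, rfl⟩ := Nat.exists_eq_add_of_le ht
        rw [Nat.cast_div (Nat.dvd_of_mem_divisors hf) hf', Nat.add_sub_cancel_left, pow_add]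
        field_simp

theorem sum_divisors_inv_pow_le (m : ℕ) {t : ℕ} (ht : 2 ≤ t) :
    ∑ f ∈ m.divisors, ((f : ℝ) ^ t)⁻¹ ≤ 2 := by
  calc _ ≤ ∑ f ∈ Finset.Icc 1 m, ((f : ℝ) ^ t)⁻¹ :=
        Finset.sum_le_sum_of_subset_of_nonneg (fun f hf => Finset.mem_Icc.2
          ⟨Nat.pos_of_mem_divisors hf, Nat.divisor_le hf⟩) fun _ _ _ => by positivity
    _ ≤ _ := by
        have := sum_Icc_inv_pow_le one_ne_zero m (t := t - 1) (by omega)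
        rw [show t - 1 + 1 = t by omega] at this
        simpa using this

/-- In the first term the divisor bound `2√m` is cancelled by `(√m)⁻¹`. The second leaves `∑
f^(-(k-1))` over divisors, bounded uniformly because `k - 1 ≥ 2`. Each part contributes `4 / m`. -/
theorem sum_Icc_gcd_weights_le {m : ℕ} (hm : m ≠ 0) (N : ℕ) {k : ℕ} (hk : 3 ≤ k) :
    ∑ q ∈ Finset.Icc m N, (q : ℝ)⁻¹ * ((√m)⁻¹ * (q.gcd m / q) + ((q.gcd m : ℝ) / q) ^ k) ≤
      8 / m := by
  have hm' : (0 : ℝ) < m := Nat.cast_pos.2 (Nat.pos_of_ne_zero hm)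
  have h1 := sum_Icc_gcd_pow_div_le hm N (le_refl 1)
  have h2 := sum_Icc_gcd_pow_div_le hm N (t := k) (by omega)
  have h3 := sum_divisors_inv_pow_le m (t := k - 1) (by omega)
  have h4 : (m.divisors.card : ℝ) ≤ 2 * √m := by
    calc (m.divisors.card : ℝ) ≤ ((2 * m.sqrt : ℕ) : ℝ) :=
          Nat.cast_le.2 m.card_divisors_le_two_mul_sqrt
      _ ≤ 2 * √m := by
          push_cast
          gcongr
          exact Real.nat_sqrt_le_real_sqrt
  simp only [pow_one, le_refl, tsub_eq_zero_of_le, pow_zero, inv_one, Finset.sum_const,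
    nsmul_eq_mul, mul_one] at h1
  have hs : (0 : ℝ) < √m := Real.sqrt_pos.2 hm'
  calc _ = (√m)⁻¹ * ∑ q ∈ Finset.Icc m N, (q.gcd m : ℝ) / (q : ℝ) ^ (1 + 1) +
        ∑ q ∈ Finset.Icc m N, (q.gcd m : ℝ) ^ k / (q : ℝ) ^ (k + 1) := by
        rw [Finset.mul_sum, ← Finset.sum_add_distrib]
        refine Finset.sum_congr rfl fun q hq => ?_
        have : (q : ℝ) ≠ 0 := Nat.cast_ne_zero.2 (by have := (Finset.mem_Icc.1 hq).1; omega)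
        rw [div_pow, pow_succ (q : ℝ) k, pow_succ (q : ℝ) 1, pow_one]
        field_simp
    _ ≤ (√m)⁻¹ * (2 / m * (2 * √m)) + 2 / m * 2 := by
        refine add_le_add (mul_le_mul_of_nonneg_left (h1.trans ?_) (by positivity)) (h2.trans ?_)
        · gcongr
        · gcongr
    _ = _ := by
        field_simp
        norm_num

/-! ### The variance of sums of hits -/

/-- The square is expanded into covariances, for which only upper bounds matter. Symmetrizing `W`
gives the factor `2`; the diagonal is then counted twice, harmlessly since `W ≥ 0`. -/
theorem integral_sq_sum_sub_le {Ω : Type*} [MeasurableSpace Ω] {P : Measure Ω}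
    [IsProbabilityMeasure P] (f : ℕ → Ω → ℝ) (hf : ∀ q, MemLp (f q) 2 P) (m : ℕ → ℝ)
    (hmean : ∀ q, q ≠ 0 → ∫ ω, f q ω ∂P = m q) (W : ℕ → ℕ → ℝ)
    (hW0 : ∀ q q', 0 ≤ W q q')
    (hW : ∀ q q', q' ≠ 0 → q' ≤ q → ∫ ω, f q ω * f q' ω ∂P - m q * m q' ≤ W q q')
    {K : ℝ} (hK : ∀ q' N, q' ≠ 0 → ∑ q ∈ Finset.Icc q' N, W q q' ≤ K / q') (M N : ℕ) :
    ∫ ω, (∑ q ∈ Finset.Ioc M N, (f q ω - m q)) ^ 2 ∂P ≤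
      2 * K * ∑ q ∈ Finset.Ioc M N, (q : ℝ)⁻¹ := by
  have hint : ∀ q q', Integrable (fun ω => f q ω * f q' ω) P := fun q q' =>
    (hf q).integrable_mul (hf q')
  have hint1 : ∀ q, Integrable (f q) P := fun q => (hf q).integrable (by norm_num)
  have hcov : ∀ q ∈ Finset.Ioc M N, ∀ q' ∈ Finset.Ioc M N,
      ∫ ω, (f q ω - m q) * (f q' ω - m q') ∂P = ∫ ω, f q ω * f q' ω ∂P - m q * m q' := by
    intro q hq q' hq'
    have e : (fun ω => (f q ω - m q) * (f q' ω - m q')) =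
        fun ω => (f q ω * f q' ω - m q' * f q ω) - (m q * f q' ω - m q * m q') := by
      funext ω; ring
    have i1 : Integrable (fun ω => f q ω * f q' ω - m q' * f q ω) P :=
      (hint q q').sub ((hint1 q).const_mul _)
    have i2 : Integrable (fun ω => m q * f q' ω - m q * m q') P :=
      ((hint1 q').const_mul _).sub (integrable_const _)
    have h1 := hmean q (by have := (Finset.mem_Ioc.1 hq).1; omega)
    have h2 := hmean q' (by have := (Finset.mem_Ioc.1 hq').1; omega)
    rw [e, integral_sub i1 i2, integral_sub (hint q q')
      ((hint1 q).const_mul _), integral_sub ((hint1 q').const_mul _) (integrable_const _),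
      integral_const_mul, integral_const_mul, h1, h2]
    simp
    ring
  have hcint : ∀ q q', Integrable (fun ω => (f q ω - m q) * (f q' ω - m q')) P := fun q q' =>
    ((hf q).sub (memLp_const _)).integrable_mul ((hf q').sub (memLp_const _))
  calc ∫ ω, (∑ q ∈ Finset.Ioc M N, (f q ω - m q)) ^ 2 ∂P
      = ∑ q ∈ Finset.Ioc M N, ∑ q' ∈ Finset.Ioc M N,
          (∫ ω, f q ω * f q' ω ∂P - m q * m q') := by
        simp_rw [sq, Finset.sum_mul_sum]
        rw [integral_finsetSum _ fun q _ => integrable_finsetSum _ fun q' _ => hcint q q']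
        refine Finset.sum_congr rfl fun q hq => ?_
        rw [integral_finsetSum _ fun q' _ => hcint q q']
        exact Finset.sum_congr rfl fun q' hq' => hcov q hq q' hq'
    _ ≤ ∑ q ∈ Finset.Ioc M N, ∑ q' ∈ Finset.Ioc M N,
          ((if q' ≤ q then W q q' else 0) + (if q ≤ q' then W q' q else 0)) := by
        refine Finset.sum_le_sum fun q hq => Finset.sum_le_sum fun q' hq' => ?_
        have h1 : q ≠ 0 := by have := (Finset.mem_Ioc.1 hq).1; omega
        have h2 : q' ≠ 0 := by have := (Finset.mem_Ioc.1 hq').1; omega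
        rcases le_total q' q with h | h
        · rw [if_pos h]
          refine (hW q q' h2 h).trans (le_add_of_nonneg_right ?_)
          split_ifs
          exacts [hW0 _ _, le_rfl]
        · rw [if_pos h]
          have := hW q' q h1 h
          simp_rw [mul_comm (f q' _), mul_comm (m q')] at this
          refine this.trans (le_add_of_nonneg_left ?_)
          split_ifs
          exacts [hW0 _ _, le_rfl]
    _ = 2 * ∑ q' ∈ Finset.Ioc M N, ∑ q ∈ Finset.Ioc M N, (if q' ≤ q then W q q' else 0) := by
        simp_rw [Finset.sum_add_distrib]
        rw [two_mul]
        congr 1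
        exact Finset.sum_comm
    _ ≤ 2 * ∑ q' ∈ Finset.Ioc M N, K / q' := by
        gcongr with q' hq'
        have h2 : q' ≠ 0 := by have := (Finset.mem_Ioc.1 hq').1; omega
        rw [← Finset.sum_filter]
        refine le_trans (Finset.sum_le_sum_of_subset_of_nonneg (fun q hq => ?_)
          fun _ _ _ => hW0 _ _) (hK q' N h2)
        simp only [Finset.mem_filter, Finset.mem_Ioc] at hq
        exact Finset.mem_Icc.2 ⟨hq.2, hq.1.2⟩
    _ = _ := by
        rw [Finset.mul_sum, Finset.mul_sum]
        refine Finset.sum_congr rfl fun q _ => ?_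
        ring

theorem add_pow_sub_pow_le {x t : ℝ} (hx : 0 ≤ x) (ht : 0 ≤ t) (n : ℕ) :
    (x + t) ^ (n + 1) - x ^ (n + 1) ≤ (n + 1) * 2 ^ n * (t * x ^ n + t ^ (n + 1)) := by
  have h1 : (x + t) ^ (n + 1) - x ^ (n + 1) ≤ (n + 1) * t * (x + t) ^ n := by
    have := (le_abs_self _).trans (abs_pow_sub_pow_le (x + t) x (n + 1))
    rw [add_sub_cancel_left, abs_of_nonneg ht, abs_of_nonneg (add_nonneg hx ht), abs_of_nonneg hx,
      max_eq_left (le_add_of_nonneg_right ht), Nat.add_sub_cancel] at this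
    push_cast at this
    linarith
  have h2 : (x + t) ^ n ≤ 2 ^ n * (x ^ n + t ^ n) := by
    refine (add_pow_le hx ht n).trans ?_
    gcongr
    · norm_num
    · omega
  calc _ ≤ _ := h1
    _ ≤ (n + 1) * t * (2 ^ n * (x ^ n + t ^ n)) := by gcongr
    _ = _ := by ring

namespace DilatedLattice

variable {G : Type*} [Group G] [MeasurableSpace G] {μ : Measure G} (A : DilatedLattice G μ)

/-- The radius of the balls around the points of `δ_q g`. -/
noncomputable def radius (C : ℝ) (q : ℕ) : ℝ := C * (q : ℝ) ^ (-(1 / (A.dim : ℝ)))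

theorem radius_nonneg {C : ℝ} (hC : 0 ≤ C) (q : ℕ) : 0 ≤ A.radius C q :=
  mul_nonneg hC (Real.rpow_nonneg (Nat.cast_nonneg q) _)

theorem radius_pow_dim (hdim : A.dim ≠ 0) (C : ℝ) (q : ℕ) :
    A.radius C q ^ A.dim = C ^ A.dim / q := by
  rw [radius, mul_pow, ← Real.rpow_mul_natCast (Nat.cast_nonneg q), neg_mul, one_div,
    inv_mul_cancel₀ (Nat.cast_ne_zero.2 hdim), Real.rpow_neg_one, div_eq_mul_inv]

/-- Since `n / (n + 1) ≥ 1/2`, the decay is at least `q^(-1/2)`, just what offsets the bound `2√q`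
for the number of divisors. -/
theorem radius_pow_le {n : ℕ} (hdim : A.dim = n + 1) (hn : 1 ≤ n) {C : ℝ} (hC : 0 ≤ C) {q : ℕ}
    (hq : q ≠ 0) : A.radius C q ^ n ≤ C ^ n * (√q)⁻¹ := by
  have hq1 : (1 : ℝ) ≤ q := by exact_mod_cast Nat.one_le_iff_ne_zero.2 hq
  rw [radius, mul_pow, ← Real.rpow_mul_natCast (Nat.cast_nonneg q), Real.sqrt_eq_rpow,
    ← Real.rpow_neg (Nat.cast_nonneg q)]
  refine mul_le_mul_of_nonneg_left (Real.rpow_le_rpow_of_exponent_le hq1 ?_) (pow_nonneg hC n)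
  rw [hdim]
  push_cast
  have hn' : (1 : ℝ) ≤ n := by exact_mod_cast hn
  rw [neg_mul, neg_le_neg_iff, one_div_mul_eq_div, div_le_div_iff₀ (by norm_num) (by positivity)]
  linarith

/-- The number of lattice points `p` for which `δ_q⁻¹ p` is close to `g`. -/
noncomputable def hits (C : ℝ) (q : ℕ) (g : G) : ℝ :=
  (A.count (A.radius C q) (A.dil q g)).toReal

theorem isProbabilityMeasure_restrict : IsProbabilityMeasure (μ.restrict A.domain) :=
  ⟨by rw [Measure.restrict_apply_univ, A.measure_domain]⟩

variable [MeasurableConstSMul G G]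

theorem measurable_count_dil (r : ℝ) (n : ℕ) : Measurable fun g => A.count r (A.dil n g) :=
  (A.measurable_count r).comp (A.measurable_dil n)

theorem measurable_hits (C : ℝ) (q : ℕ) : Measurable (A.hits C q) :=
  (A.measurable_count_dil _ q).ennreal_toReal

variable [SMulInvariantMeasure G G μ]

theorem count_ne_top {r : ℝ} (hr : 0 ≤ r) (g : G) : A.count r g ≠ ∞ :=
  ((A.count_le hr g).trans_lt ENNReal.ofReal_lt_top).ne

theorem memLp_hits {C : ℝ} (hC : 0 ≤ C) (q : ℕ) : MemLp (A.hits C q) 2 (μ.restrict A.domain) := by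
  have := A.isProbabilityMeasure_restrict
  refine MemLp.of_bound (A.measurable_hits C q).aestronglyMeasurable
    (A.vol * (A.radius C q + A.diam) ^ A.dim) (ae_of_all _ fun g => ?_)
  rw [hits, Real.norm_of_nonneg ENNReal.toReal_nonneg]
  refine ENNReal.toReal_le_of_le_ofReal ?_ (A.count_le (A.radius_nonneg hC q) _)
  exact mul_nonneg A.vol_nonneg (pow_nonneg (add_nonneg (A.radius_nonneg hC q) A.diam_nonneg) _)

theorem integral_hits (hdim : A.dim ≠ 0) {C : ℝ} (hC : 0 ≤ C) {q : ℕ} (hq : q ≠ 0) :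
    ∫ g in A.domain, A.hits C q g ∂μ = A.vol * (C ^ A.dim / q) := by
  have hr := A.radius_nonneg hC q
  unfold hits
  rw [integral_toReal (A.measurable_count_dil _ q).aemeasurable
    (ae_of_all _ fun g => (A.count_ne_top hr _).lt_top),
    A.setLIntegral_comp_dil (A.measurable_count _) (fun γ g => A.count_mul_left _ γ g) hq,
    A.setLIntegral_count hr, A.radius_pow_dim hdim, ENNReal.toReal_ofReal]
  exact mul_nonneg A.vol_nonneg (by positivity)

theorem integral_hits_mul_hits (hdim : A.dim ≠ 0) {C : ℝ} (hC : 0 ≤ C) {q q' : ℕ} (hq : q ≠ 0) :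
    ∫ g in A.domain, A.hits C q g * A.hits C q' g ∂μ ≤
      A.vol ^ 2 * (C ^ A.dim / q) *
        (A.radius C q' + A.diam * (q.gcd q' / q)) ^ A.dim := by
  have hr := A.radius_nonneg hC q
  have hr' := A.radius_nonneg hC q'
  have hd : q.gcd q' ≠ 0 := Nat.gcd_ne_zero_left hq
  obtain ⟨a, ha⟩ := Nat.gcd_dvd_left q q'
  obtain ⟨b, hb⟩ := Nat.gcd_dvd_right q q'
  have hq0 : (q : ℝ) ≠ 0 := Nat.cast_ne_zero.2 hq
  have ha0 : a ≠ 0 := by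
    rintro rfl
    exact hq (by rw [ha, mul_zero])
  have hab : a.Coprime b := by
    have := Nat.coprime_div_gcd_div_gcd (Nat.pos_of_ne_zero hd)
    rwa [Nat.div_eq_of_eq_mul_right (Nat.pos_of_ne_zero hd) ha,
      Nat.div_eq_of_eq_mul_right (Nat.pos_of_ne_zero hd) hb] at this
  have hdiv : A.diam * ((q.gcd q' : ℝ) / q) = A.diam / a := by
    have h1 : (q : ℝ) = q.gcd q' * a := by exact_mod_cast ha
    have h2 : ((q.gcd q' : ℝ) / q) = 1 / a := by
      rw [div_eq_div_iff hq0 (Nat.cast_ne_zero.2 ha0), one_mul, ← h1]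
    rw [h2, mul_one_div]
  have key := A.setLIntegral_count_mul_count hd ha0 hab hr hr'
  rw [← ha, ← hb] at key
  unfold hits
  simp_rw [← ENNReal.toReal_mul]
  have hm : AEMeasurable (fun g => A.count (A.radius C q) (A.dil q g) *
      A.count (A.radius C q') (A.dil q' g)) (μ.restrict A.domain) :=
    ((A.measurable_count_dil _ q).mul (A.measurable_count_dil _ q')).aemeasurable
  rw [integral_toReal hm
    (ae_of_all _ fun g => ENNReal.mul_lt_top (A.count_ne_top hr _).lt_top
      (A.count_ne_top hr' _).lt_top), hdiv, ← A.radius_pow_dim hdim]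
  refine ENNReal.toReal_le_of_le_ofReal ?_ key
  have : 0 ≤ A.diam / a := div_nonneg A.diam_nonneg (Nat.cast_nonneg a)
  positivity

theorem exists_integral_sq_sum_hits_le (hdim : 3 ≤ A.dim) {C : ℝ} (hC : 0 ≤ C) :
    ∃ K : ℝ, 0 ≤ K ∧ ∀ M N : ℕ,
      ∫ g in A.domain, (∑ q ∈ Finset.Ioc M N, (A.hits C q g - A.vol * (C ^ A.dim / q))) ^ 2 ∂μ ≤
        K * ∑ q ∈ Finset.Ioc M N, (q : ℝ)⁻¹ := by
  have := A.isProbabilityMeasure_restrict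
  have h0 : A.dim ≠ 0 := by omega
  obtain ⟨n, hn⟩ : ∃ n, A.dim = n + 1 := ⟨A.dim - 1, by omega⟩
  set c := A.diam with hc
  have hc0 : 0 ≤ c := A.diam_nonneg
  set K₁ : ℝ := A.vol ^ 2 * C ^ A.dim * ((n + 1) * 2 ^ n) * (c * C ^ n + c ^ (n + 1)) with hK₁
  have hK₁0 : 0 ≤ K₁ := by positivity
  let W : ℕ → ℕ → ℝ := fun q q' => K₁ * ((q : ℝ)⁻¹ * ((√q')⁻¹ * (q.gcd q' / q) +
    ((q.gcd q' : ℝ) / q) ^ A.dim))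
  refine ⟨2 * (K₁ * 8), by positivity, fun M N => ?_⟩
  refine integral_sq_sum_sub_le (A.hits C) (A.memLp_hits hC) (fun q => A.vol * (C ^ A.dim / q))
    (fun q hq => A.integral_hits h0 hC hq) W (fun q q' => by positivity) ?_ ?_ M N
  · intro q q' hq' hqq'
    have hq : q ≠ 0 := by omega
    have hx := A.radius_nonneg hC q'
    set x := A.radius C q' with hxdef
    set u : ℝ := (q.gcd q' : ℝ) / q with hu
    have hu0 : 0 ≤ u := by positivity
    have h1 := A.integral_hits_mul_hits h0 hC hq (q' := q')
    have h2 := add_pow_sub_pow_le hx (mul_nonneg hc0 hu0) n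
    have h3 : x ^ n ≤ C ^ n * (√q')⁻¹ := A.radius_pow_le hn (by omega) hC hq'
    have h4 : x ^ (n + 1) = C ^ A.dim / q' := by rw [← hn, A.radius_pow_dim h0]
    have hb : 0 ≤ A.vol ^ 2 * (C ^ A.dim / q) := by positivity
    have hs : 0 ≤ (√(q' : ℝ))⁻¹ := by positivity
    -- The product of the means is the value of the second-moment bound at `u = 0`, so the
    -- covariance is controlled by a difference of `dim`-th powers.
    calc _ ≤ A.vol ^ 2 * (C ^ A.dim / q) * (x + c * u) ^ A.dim -
          A.vol * (C ^ A.dim / q) * (A.vol * (C ^ A.dim / q')) := by linarith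
      _ = A.vol ^ 2 * (C ^ A.dim / q) * ((x + c * u) ^ (n + 1) - x ^ (n + 1)) := by
          rw [h4, ← hn]
          ring
      _ ≤ A.vol ^ 2 * (C ^ A.dim / q) * ((n + 1) * 2 ^ n *
            (c * u * (C ^ n * (√q')⁻¹) + (c * u) ^ (n + 1))) := by
          refine mul_le_mul_of_nonneg_left (h2.trans ?_) hb
          gcongr
      _ ≤ W q q' := by
          have e : W q q' = A.vol ^ 2 * (C ^ A.dim / q) * ((n + 1) * 2 ^ n *
            ((c * C ^ n + c ^ (n + 1)) * ((√q')⁻¹ * u + u ^ (n + 1)))) := by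
            simp only [W, hK₁]
            rw [← hn]
            ring
          rw [e]
          refine mul_le_mul_of_nonneg_left (mul_le_mul_of_nonneg_left ?_ (by positivity)) hb
          have p1 : 0 ≤ c ^ (n + 1) * ((√q')⁻¹ * u) := by positivity
          have p2 : 0 ≤ c * C ^ n * u ^ (n + 1) := by positivity
          rw [mul_pow]
          linarith
  · intro q' N hq'
    simp only [W]
    rw [← Finset.mul_sum, mul_div_assoc]
    exact mul_le_mul_of_nonneg_left (sum_Icc_gcd_weights_le hq' N hdim) hK₁0

end DilatedLattice

/-! ### Almost sure bounds for partial sums from second moments -/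

/-- The sum of the squares of all sums of `x` over dyadic blocks in `[0, 2 ^ r)`. -/
def dyadicSquareSum (r : ℕ) (x : ℕ → ℝ) : ℝ :=
  ∑ s ∈ Finset.range (r + 1), ∑ i ∈ Finset.range (2 ^ (r - s)),
    (∑ j ∈ Finset.Ico (i * 2 ^ s) ((i + 1) * 2 ^ s), x j) ^ 2

theorem dyadicSquareSum_nonneg (r : ℕ) (x : ℕ → ℝ) : 0 ≤ dyadicSquareSum r x :=
  Finset.sum_nonneg fun _ _ => Finset.sum_nonneg fun _ _ => sq_nonneg _

/-- Erasing the binary digits of `v` one at a time cuts `[0, v)` into at most one dyadic block for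
each scale `2^s`, `s ≤ r`. Cauchy–Schwarz over the `r + 1` scales gives the factor. -/
theorem sq_sum_range_le_dyadicSquareSum {r v : ℕ} (hv : v ≤ 2 ^ r) (x : ℕ → ℝ) :
    (∑ j ∈ Finset.range v, x j) ^ 2 ≤ (r + 1) * dyadicSquareSum r x := by
  let z : ℕ → ℝ := fun s => ∑ j ∈ Finset.range (v / 2 ^ s * 2 ^ s), x j
  have hz0 : z 0 = ∑ j ∈ Finset.range v, x j := by simp [z]
  have hzr : z (r + 1) = 0 := by
    have : v / 2 ^ (r + 1) = 0 := Nat.div_eq_of_lt (hv.trans_lt (Nat.pow_lt_pow_succ (by norm_num)))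
    simp [z, this]
  have htel : ∑ j ∈ Finset.range v, x j = ∑ s ∈ Finset.range (r + 1), (z s - z (s + 1)) := by
    rw [Finset.sum_range_sub', hz0, hzr, sub_zero]
  rw [htel]
  refine sq_sum_le_card_mul_sum_sq.trans ?_
  rw [Finset.card_range, Nat.cast_add, Nat.cast_one, dyadicSquareSum]
  refine mul_le_mul_of_nonneg_left (Finset.sum_le_sum fun s hs => ?_) (by positivity)
  have hs' : s ≤ r := Nat.lt_succ_iff.1 (Finset.mem_range.1 hs)
  have hdiv : v / 2 ^ (s + 1) = v / 2 ^ s / 2 := by rw [pow_succ, Nat.div_div_eq_div_mul]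
  rcases Nat.even_or_odd' (v / 2 ^ s) with ⟨i, hi | hi⟩
  · have : z s = z (s + 1) := by
      simp only [z, hdiv, hi]
      rw [Nat.mul_div_cancel_left i (by norm_num), pow_succ]
      congr 2
      ring
    rw [this, sub_self, zero_pow two_ne_zero]
    exact Finset.sum_nonneg fun _ _ => sq_nonneg _
  · have h1 : z s - z (s + 1) = ∑ j ∈ Finset.Ico (2 * i * 2 ^ s) ((2 * i + 1) * 2 ^ s), x j := by
      rw [Finset.sum_Ico_eq_sub _ (Nat.mul_le_mul_right _ (Nat.le_succ _))]
      simp only [z, hdiv, hi]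
      rw [show (2 * i + 1) / 2 = i by omega, pow_succ]
      congr 3
      ring
    have h2 : 2 * i + 1 ≤ 2 ^ (r - s) := by
      rw [← hi, ← Nat.pow_div hs' (by norm_num)]
      exact Nat.div_le_div_right hv
    rw [h1]
    exact Finset.single_le_sum (f := fun i =>
      (∑ j ∈ Finset.Ico (i * 2 ^ s) ((i + 1) * 2 ^ s), x j) ^ 2) (fun _ _ => sq_nonneg _)
      (Finset.mem_range.2 (Nat.lt_of_succ_le h2))

section Dyadic

variable {Ω : Type*} [MeasurableSpace Ω] {P : Measure Ω} {X : ℕ → Ω → ℝ}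

theorem integrable_dyadicSquareSum (hX : ∀ j, MemLp (X j) 2 P) (r : ℕ) :
    Integrable (fun ω => dyadicSquareSum r fun j => X j ω) P :=
  integrable_finsetSum _ fun _ _ => integrable_finsetSum _ fun _ _ =>
    (memLp_finsetSum _ fun j _ => hX j).integrable_sq

theorem integral_dyadicSquareSum_le (hX : ∀ j, MemLp (X j) 2 P) {K : ℝ}
    (hK : ∀ u v : ℕ, u ≤ v →
      ∫ ω, (∑ j ∈ Finset.Ico u v, X j ω) ^ 2 ∂P ≤ K * ((v : ℝ) - u)) (r : ℕ) :
    ∫ ω, dyadicSquareSum r (fun j => X j ω) ∂P ≤ (r + 1) * (K * 2 ^ r) := by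
  have hint : ∀ u v, Integrable (fun ω => (∑ j ∈ Finset.Ico u v, X j ω) ^ 2) P := fun u v =>
    (memLp_finsetSum _ fun j _ => hX j).integrable_sq
  unfold dyadicSquareSum
  rw [integral_finsetSum _ fun s _ => integrable_finsetSum _ fun i _ => hint _ _]
  calc _ ≤ ∑ s ∈ Finset.range (r + 1), K * 2 ^ r := Finset.sum_le_sum fun s hs => by
        have hs' : s ≤ r := Nat.lt_succ_iff.1 (Finset.mem_range.1 hs)
        rw [integral_finsetSum _ fun i _ => hint _ _]
        calc _ ≤ ∑ i ∈ Finset.range (2 ^ (r - s)), K * 2 ^ s := Finset.sum_le_sum fun i _ => by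
              refine (hK _ _ (Nat.mul_le_mul_right _ (Nat.le_succ _))).trans_eq ?_
              push_cast
              ring
          _ = K * 2 ^ r := by
              rw [Finset.sum_const, Finset.card_range, nsmul_eq_mul, mul_left_comm]
              push_cast
              rw [← pow_add, Nat.sub_add_cancel hs']
    _ = _ := by
        rw [Finset.sum_const, Finset.card_range, nsmul_eq_mul]
        push_cast
        ring

/-- The mean of the dyadic square sum is at most `(r + 1) K 2^r`. The weights `w r` make these means
summable, so almost surely the weighted series converges and its sum `c` bounds each term.
Cauchy–Schwarz costs one more factor `r + 1`, whence the exponent `3 + 2ε`. -/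
theorem ae_exists_sq_sum_range_le (hX : ∀ j, MemLp (X j) 2 P) {K : ℝ}
    (hK : ∀ u v : ℕ, u ≤ v →
      ∫ ω, (∑ j ∈ Finset.Ico u v, X j ω) ^ 2 ∂P ≤ K * ((v : ℝ) - u)) {ε : ℝ} (hε : 0 < ε) :
    ∀ᵐ ω ∂P, ∃ c : ℝ, 0 ≤ c ∧ ∀ r v : ℕ, v ≤ 2 ^ r →
      (∑ j ∈ Finset.range v, X j ω) ^ 2 ≤ c * 2 ^ r * ((r : ℝ) + 1) ^ (3 + 2 * ε) := by
  let w : ℕ → ℝ := fun r => (2 ^ r * ((r : ℝ) + 1) ^ (2 + 2 * ε))⁻¹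
  have hw : ∀ r, 0 < w r := fun r => by positivity
  have hsum : Summable fun r : ℕ => K * ((r : ℝ) + 1) ^ (-(1 + 2 * ε)) := by
    refine Summable.mul_left _ ?_
    have := (summable_nat_add_iff (f := fun r : ℕ => (r : ℝ) ^ (-(1 + 2 * ε))) 1).2
      (Real.summable_nat_rpow.2 (by linarith))
    simpa using this
  have hint := fun r => integrable_dyadicSquareSum hX r
  have hmeas : ∀ r, AEMeasurable
      (fun ω => ENNReal.ofReal (w r * dyadicSquareSum r fun j => X j ω)) P := fun r =>
    ((hint r).aestronglyMeasurable.aemeasurable.const_mul _).ennreal_ofReal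
  have hfin : ∫⁻ ω, ∑' r, ENNReal.ofReal (w r * dyadicSquareSum r fun j => X j ω) ∂P ≠ ∞ := by
    rw [lintegral_tsum hmeas]
    refine ne_top_of_le_ne_top hsum.tsum_ofReal_ne_top (ENNReal.tsum_le_tsum fun r => ?_)
    rw [← ofReal_integral_eq_lintegral_ofReal ((hint r).const_mul _)
      (ae_of_all _ fun ω => mul_nonneg (hw r).le (dyadicSquareSum_nonneg r _)),
      integral_const_mul]
    refine ENNReal.ofReal_le_ofReal ?_
    calc _ ≤ w r * ((r + 1) * (K * 2 ^ r)) :=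
          mul_le_mul_of_nonneg_left (integral_dyadicSquareSum_le hX hK r) (hw r).le
      _ = _ := by
          have hr : (0 : ℝ) < (r : ℝ) + 1 := by positivity
          simp only [w]
          rw [show (2 + 2 * ε) = 1 + (1 + 2 * ε) by ring, Real.rpow_add hr, Real.rpow_one,
            Real.rpow_neg hr.le]
          field_simp
  filter_upwards [ae_lt_top' (AEMeasurable.tsum hmeas) hfin] with ω hω
  refine ⟨(∑' r, ENNReal.ofReal (w r * dyadicSquareSum r fun j => X j ω)).toReal,
    ENNReal.toReal_nonneg, fun r v hv => ?_⟩
  set c := (∑' r, ENNReal.ofReal (w r * dyadicSquareSum r fun j => X j ω)).toReal with hc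
  have h1 : w r * dyadicSquareSum r (fun j => X j ω) ≤ c :=
    (ENNReal.ofReal_le_iff_le_toReal hω.ne).1 (ENNReal.le_tsum r)
  have hr : (0 : ℝ) < (r : ℝ) + 1 := by positivity
  have h2 : dyadicSquareSum r (fun j => X j ω) ≤ c * (2 ^ r * ((r : ℝ) + 1) ^ (2 + 2 * ε)) := by
    simp only [w] at h1
    rwa [inv_mul_le_iff₀ (by positivity), mul_comm] at h1
  calc _ ≤ (r + 1) * dyadicSquareSum r (fun j => X j ω) := sq_sum_range_le_dyadicSquareSum hv _
    _ ≤ (r + 1) * (c * (2 ^ r * ((r : ℝ) + 1) ^ (2 + 2 * ε))) := by gcongr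
    _ = _ := by
        rw [show (3 + 2 * ε) = 1 + (2 + 2 * ε) by ring, Real.rpow_add hr 1, Real.rpow_one]
        ring

theorem ae_exists_abs_sum_range_le (hX : ∀ j, MemLp (X j) 2 P) {K : ℝ}
    (hK : ∀ u v : ℕ, u ≤ v →
      ∫ ω, (∑ j ∈ Finset.Ico u v, X j ω) ^ 2 ∂P ≤ K * ((v : ℝ) - u)) {ε : ℝ} (hε : 0 < ε) :
    ∀ᵐ ω ∂P, ∃ c : ℝ, 0 ≤ c ∧ ∀ v : ℕ, |∑ j ∈ Finset.range v, X j ω| ≤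
      c * ((v : ℝ) ^ (1 / 2 : ℝ) * ((Nat.log 2 v : ℝ) + 2) ^ (3 / 2 + ε)) := by
  filter_upwards [ae_exists_sq_sum_range_le hX hK hε] with ω ⟨c, hc0, hc⟩
  -- The bound is used at the scale `r = l + 1` with `l = Nat.log 2 v`; the factor `2` comes from
  -- `2^(l+1) ≤ 2 v`.
  refine ⟨√(2 * c), Real.sqrt_nonneg _, fun v => ?_⟩
  rcases Nat.eq_zero_or_pos v with rfl | hv
  · simp only [Finset.range_zero, Finset.sum_empty, abs_zero]
    positivity
  set l := Nat.log 2 v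
  have h1 : v < 2 ^ (l + 1) := Nat.lt_pow_succ_log_self (by norm_num) v
  have h2 : 2 ^ l ≤ v := Nat.pow_log_le_self 2 hv.ne'
  have h2' : (2 : ℝ) ^ l ≤ v := by exact_mod_cast h2
  have h3 := hc (l + 1) v h1.le
  refine abs_le_of_sq_le_sq ?_ (by positivity)
  refine h3.trans ?_
  have hl : (0 : ℝ) ≤ (l : ℝ) + 2 := by positivity
  rw [mul_pow, mul_pow, Real.sq_sqrt (by positivity), ← Real.rpow_mul_natCast (Nat.cast_nonneg v),
    ← Real.rpow_mul_natCast hl, show ((l + 1 : ℕ) : ℝ) + 1 = l + 2 by push_cast; ring]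
  rw [show (1 / 2 : ℝ) * (2 : ℕ) = 1 by norm_num, Real.rpow_one,
    show (3 / 2 + ε) * (2 : ℕ) = 3 + 2 * ε by push_cast; ring, ← mul_assoc]
  refine mul_le_mul_of_nonneg_right ?_ (by positivity)
  rw [pow_succ]
  nlinarith

end Dyadic

/-! ### From dyadic blocks to all `N` -/

theorem sum_Ioc_two_pow (x : ℕ → ℝ) {u v : ℕ} (huv : u ≤ v) :
    ∑ j ∈ Finset.Ico u v, ∑ q ∈ Finset.Ioc (2 ^ j) (2 ^ (j + 1)), x q =
      ∑ q ∈ Finset.Ioc (2 ^ u) (2 ^ v), x q := by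
  induction v, huv using Nat.le_induction with
  | base => simp
  | succ v huv ih =>
      rw [Finset.sum_Ico_succ_top huv, ih]
      exact Finset.sum_Ioc_consecutive x (Nat.pow_le_pow_right (by norm_num) huv)
        (Nat.pow_le_pow_right (by norm_num) (Nat.le_succ v))

theorem sum_Ioc_two_pow_inv_le {u v : ℕ} (huv : u ≤ v) :
    ∑ q ∈ Finset.Ioc (2 ^ u : ℕ) (2 ^ v), (q : ℝ)⁻¹ ≤ (v : ℝ) - u := by
  rw [← sum_Ioc_two_pow _ huv]
  calc _ ≤ ∑ j ∈ Finset.Ico u v, (1 : ℝ) := Finset.sum_le_sum fun j _ => by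
        calc _ ≤ ∑ q ∈ Finset.Ioc (2 ^ j : ℕ) (2 ^ (j + 1)), ((2 : ℝ) ^ j)⁻¹ :=
              Finset.sum_le_sum fun q hq => by
                have : 2 ^ j ≤ q := (Finset.mem_Ioc.1 hq).1.le
                have : (2 : ℝ) ^ j ≤ q := by exact_mod_cast this
                gcongr
          _ = 1 := by
              rw [Finset.sum_const, Nat.card_Ioc, nsmul_eq_mul, pow_succ, mul_two,
                Nat.add_sub_cancel]
              push_cast
              exact mul_inv_cancel₀ (by positivity)
    _ = _ := by
        rw [Finset.sum_const, Nat.card_Ico, nsmul_eq_mul, mul_one, Nat.cast_sub huv]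

theorem abs_sum_Ioc_inv_sub_log_le {n : ℕ} (hn : n ≠ 0) :
    |∑ q ∈ Finset.Ioc 1 n, (q : ℝ)⁻¹ - Real.log n| ≤ 1 := by
  have h : ∑ q ∈ Finset.Ioc 1 n, (q : ℝ)⁻¹ = harmonic n - 1 := by
    rw [harmonic_eq_sum_Icc, ← Finset.add_sum_Ioc_eq_sum_Icc (Nat.one_le_iff_ne_zero.2 hn)]
    push_cast
    simp
  have h1 := harmonic_le_one_add_log n
  have h2 := log_add_one_le_harmonic n
  have h3 : Real.log n ≤ Real.log (n + 1 : ℕ) :=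
    Real.log_le_log (Nat.cast_pos.2 (Nat.pos_of_ne_zero hn)) (by push_cast; linarith)
  rw [h, abs_le]
  constructor <;> linarith

/-- The sum of a nonnegative sequence is controlled by its centered sums along powers of two. -/
theorem abs_sum_sub_log_le {x : ℕ → ℝ} (hx : ∀ q, 0 ≤ x q) {a : ℝ} (ha : 0 ≤ a) {B : ℕ → ℝ}
    (hB : Monotone B)
    (h : ∀ v : ℕ, |∑ q ∈ Finset.Ioc (2 ^ 0) (2 ^ v), (x q - a * (q : ℝ)⁻¹)| ≤ B v) {N : ℕ}
    (hN : N ≠ 0) :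
    |∑ q ∈ Finset.Icc 1 N, x q - a * Real.log N| ≤ x 1 + 2 * a + B (Nat.log 2 N + 1) := by
  set v := Nat.log 2 N
  have h1 : N ≤ 2 ^ (v + 1) := (Nat.lt_pow_succ_log_self (by norm_num) N).le
  have h2 : 2 ^ v ≤ N := Nat.pow_log_le_self 2 hN
  have hpos : (0 : ℝ) < N := Nat.cast_pos.2 (Nat.pos_of_ne_zero hN)
  have hlog2 : Real.log 2 ≤ 1 := by linarith [Real.log_two_lt_d9]
  have l1 : Real.log N ≤ Real.log (2 ^ v : ℕ) + 1 := by
    have : Real.log N ≤ Real.log ((2 ^ (v + 1) : ℕ) : ℝ) :=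
      Real.log_le_log hpos (Nat.cast_le.2 h1)
    push_cast at this ⊢
    rw [Real.log_pow] at this ⊢
    push_cast at this
    linarith
  have l2 : Real.log (2 ^ (v + 1) : ℕ) ≤ Real.log N + 1 := by
    have : Real.log ((2 ^ v : ℕ) : ℝ) ≤ Real.log N :=
      Real.log_le_log (by positivity) (Nat.cast_le.2 h2)
    push_cast at this ⊢
    rw [Real.log_pow] at this ⊢
    push_cast
    linarith
  have hsplit : ∀ n, 1 ≤ n → ∑ q ∈ Finset.Icc 1 n, x q = x 1 + ∑ q ∈ Finset.Ioc 1 n, x q :=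
    fun n hn => (Finset.add_sum_Ioc_eq_sum_Icc hn).symm
  have hmono : ∀ m n : ℕ, m ≤ n → ∑ q ∈ Finset.Icc 1 m, x q ≤ ∑ q ∈ Finset.Icc 1 n, x q :=
    fun m n hmn => Finset.sum_le_sum_of_subset_of_nonneg
      (Finset.Icc_subset_Icc_right hmn) fun _ _ _ => hx _
  -- Replacing the harmonic sum by the logarithm costs `a`. Moving from a power of two to `N` costs
  -- `a` again, as `log 2 ≤ 1`.
  have hpow : ∀ v : ℕ, |∑ q ∈ Finset.Icc 1 (2 ^ v), x q - x 1 - a * Real.log (2 ^ v : ℕ)| ≤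
      a + B v := by
    intro v
    have e : ∑ q ∈ Finset.Icc 1 (2 ^ v), x q - x 1 - a * Real.log (2 ^ v : ℕ) =
        a * (∑ q ∈ Finset.Ioc (1 : ℕ) (2 ^ v), (q : ℝ)⁻¹ - Real.log (2 ^ v : ℕ)) +
          ∑ q ∈ Finset.Ioc (2 ^ 0) (2 ^ v), (x q - a * (q : ℝ)⁻¹) := by
      rw [hsplit _ Nat.one_le_two_pow, Finset.sum_sub_distrib, ← Finset.mul_sum, pow_zero]
      ring
    rw [e]
    refine (abs_add_le _ _).trans (add_le_add ?_ (h v))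
    rw [abs_mul, abs_of_nonneg ha]
    have := abs_sum_Ioc_inv_sub_log_le (n := 2 ^ v) (by positivity)
    nlinarith
  have b1 := abs_le.1 (hpow v)
  have b2 := abs_le.1 (hpow (v + 1))
  have m1 := hmono _ _ h1
  have m2 := hmono _ _ h2
  have hBv := hB (Nat.le_succ v)
  have a1 := mul_le_mul_of_nonneg_left l1 ha
  have a2 := mul_le_mul_of_nonneg_left l2 ha
  have hx1 := hx 1
  rw [abs_le]
  simp only [Nat.succ_eq_add_one] at hBv
  constructor <;> linarith [b1.1, b1.2, b2.1, b2.2]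

theorem isBigO_log_bound {ε : ℝ} (hε : 0 < ε) (b c : ℝ) :
    (fun N : ℕ => b + c * (((Nat.log 2 N + 1 : ℕ) : ℝ) ^ (1 / 2 : ℝ) *
      ((Nat.log 2 (Nat.log 2 N + 1) : ℝ) + 2) ^ (3 / 2 + ε)))
      =O[atTop] fun N : ℕ =>
        Real.log N ^ (1 / 2 : ℝ) * Real.log (Real.log N) ^ (3 / 2 + ε) := by
  have t1 : Tendsto (fun N : ℕ => Real.log N) atTop atTop :=
    Real.tendsto_log_atTop.comp tendsto_natCast_atTop_atTop
  have t2 : Tendsto (fun N : ℕ => Real.log (Real.log N)) atTop atTop :=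
    Real.tendsto_log_atTop.comp t1
  have hl2 := Real.log_two_gt_d9
  have key : ∀ n : ℕ, n ≠ 0 → (Nat.log 2 n : ℝ) * Real.log 2 ≤ Real.log n := fun n hn => by
    have : ((2 ^ Nat.log 2 n : ℕ) : ℝ) ≤ n := Nat.cast_le.2 (Nat.pow_log_le_self 2 hn)
    have h := Real.log_le_log (by positivity) this
    rwa [Nat.cast_pow, Real.log_pow] at h
  refine IsBigO.add ?_ (IsBigO.const_mul_left ?_ c)
  · refine IsBigO.of_bound |b| ?_
    filter_upwards [t1.eventually_ge_atTop 1, t2.eventually_ge_atTop 1] with N h1 h2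
    have : 1 ≤ Real.log N ^ (1 / 2 : ℝ) * Real.log (Real.log N) ^ (3 / 2 + ε) :=
      one_le_mul_of_one_le_of_one_le (Real.one_le_rpow h1 (by norm_num))
        (Real.one_le_rpow h2 (by linarith))
    rw [Real.norm_eq_abs, Real.norm_of_nonneg (by linarith)]
    exact le_mul_of_one_le_right (abs_nonneg b) this
  · refine IsBigO.mul (IsBigO.of_bound (3 ^ (1 / 2 : ℝ)) ?_)
      (IsBigO.of_bound (5 ^ (3 / 2 + ε)) ?_)
    all_goals
      filter_upwards [t1.eventually_ge_atTop 2, t2.eventually_ge_atTop 2,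
        eventually_ne_atTop 0] with N h1 h2 h3
      have h4 : ((Nat.log 2 N + 1 : ℕ) : ℝ) ≤ 3 * Real.log N := by
        have := key N h3
        have h0 : (0 : ℝ) ≤ Nat.log 2 N := Nat.cast_nonneg _
        push_cast
        nlinarith
    · rw [Real.norm_of_nonneg (by positivity), Real.norm_of_nonneg (by positivity),
        ← Real.mul_rpow (by norm_num) (by linarith)]
      exact Real.rpow_le_rpow (by positivity) h4 (by norm_num)
    · rw [Real.norm_of_nonneg (by positivity),
        Real.norm_of_nonneg (Real.rpow_nonneg (by linarith) _),
        ← Real.mul_rpow (by norm_num) (by linarith)]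
      refine Real.rpow_le_rpow (by positivity) ?_ (by linarith)
      have h5 := key (Nat.log 2 N + 1) (Nat.succ_ne_zero _)
      have h6 : Real.log ((Nat.log 2 N + 1 : ℕ) : ℝ) ≤ Real.log 3 + Real.log (Real.log N) := by
        rw [← Real.log_mul (by norm_num) (by linarith)]
        exact Real.log_le_log (by positivity) h4
      have h7 : Real.log 3 ≤ 2 := by
        have := Real.log_le_sub_one_of_pos (show (0 : ℝ) < 3 by norm_num)
        linarith
      have h0 : (0 : ℝ) ≤ Nat.log 2 (Nat.log 2 N + 1) := Nat.cast_nonneg _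
      nlinarith

/-- A quantitative strong law for nonnegative random variables with means `a / q` and almost
uncorrelated in the sense that the variance of their sums over blocks is `O(∑ 1 / q)`. -/
theorem ae_isBigO_sum_sub_log {Ω : Type*} [MeasurableSpace Ω] {P : Measure Ω}
    [IsFiniteMeasure P] {f : ℕ → Ω → ℝ} (hf : ∀ q, MemLp (f q) 2 P) (hf0 : ∀ q ω, 0 ≤ f q ω)
    {a K : ℝ} (ha : 0 ≤ a) (hK0 : 0 ≤ K)
    (hK : ∀ M N : ℕ, ∫ ω, (∑ q ∈ Finset.Ioc M N, (f q ω - a * (q : ℝ)⁻¹)) ^ 2 ∂P ≤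
      K * ∑ q ∈ Finset.Ioc M N, (q : ℝ)⁻¹) {ε : ℝ} (hε : 0 < ε) :
    ∀ᵐ ω ∂P, (fun N : ℕ => ∑ q ∈ Finset.Icc 1 N, f q ω - a * Real.log N) =O[atTop]
      fun N : ℕ => Real.log N ^ (1 / 2 : ℝ) * Real.log (Real.log N) ^ (3 / 2 + ε) := by
  -- Over each such block `∑ 1/q ≤ 1`, so the variance of a run of these variables is at most `K`
  -- times its length.
  let X : ℕ → Ω → ℝ := fun j ω =>
    ∑ q ∈ Finset.Ioc (2 ^ j) (2 ^ (j + 1)), (f q ω - a * (q : ℝ)⁻¹)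
  have hX : ∀ j, MemLp (X j) 2 P := fun j =>
    memLp_finsetSum _ fun q _ => (hf q).sub (memLp_const _)
  have hXK : ∀ u v : ℕ, u ≤ v →
      ∫ ω, (∑ j ∈ Finset.Ico u v, X j ω) ^ 2 ∂P ≤ K * ((v : ℝ) - u) := fun u v huv => by
    simp only [X]
    simp_rw [sum_Ioc_two_pow (fun q => f q _ - a * (q : ℝ)⁻¹) huv]
    exact (hK _ _).trans (mul_le_mul_of_nonneg_left (sum_Ioc_two_pow_inv_le huv) hK0)
  filter_upwards [ae_exists_abs_sum_range_le hX hXK hε] with ω ⟨c, hc0, hc⟩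
  let B : ℕ → ℝ := fun v => c * ((v : ℝ) ^ (1 / 2 : ℝ) * ((Nat.log 2 v : ℝ) + 2) ^ (3 / 2 + ε))
  have hB : Monotone B := fun u v huv => by
    have : Nat.log 2 u ≤ Nat.log 2 v := Nat.log_mono_right huv
    simp only [B]
    gcongr
  refine IsBigO.trans (IsBigO.of_bound 1 ?_) (isBigO_log_bound hε (f 1 ω + 2 * a) c)
  filter_upwards [eventually_ne_atTop 0] with N hN
  have := abs_sum_sub_log_le (fun q => hf0 q ω) ha hB (fun v => by
    rw [← sum_Ioc_two_pow _ (Nat.zero_le v), ← Finset.range_eq_Ico]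
    exact hc v) hN
  rw [one_mul, Real.norm_eq_abs]
  exact this.trans (le_abs_self _)

theorem finite_and_ncard_prod_nat {α : Type*} (s : ℕ → Set α) (hs : ∀ q, (s q).Finite) (N : ℕ) :
    {x : α × ℕ | 1 ≤ x.2 ∧ x.2 ≤ N ∧ x.1 ∈ s x.2}.Finite ∧
      {x : α × ℕ | 1 ≤ x.2 ∧ x.2 ≤ N ∧ x.1 ∈ s x.2}.ncard =
        ∑ q ∈ Finset.Icc 1 N, (s q).ncard := by
  classical
  let F : Finset (α × ℕ) := (Finset.Icc 1 N).biUnion fun q =>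
    (hs q).toFinset.map ⟨fun a => (a, q), fun _ _ h => congrArg Prod.fst h⟩
  have hF : {x : α × ℕ | 1 ≤ x.2 ∧ x.2 ≤ N ∧ x.1 ∈ s x.2} = F := by
    ext ⟨a, q⟩
    simp only [Set.mem_ofPred_eq, F, Finset.coe_biUnion, Set.mem_iUnion, Finset.coe_map,
      Set.mem_image, Finset.mem_coe, Finset.mem_Icc, Set.Finite.mem_toFinset,
      exists_prop]
    constructor
    · rintro ⟨h1, h2, h3⟩
      exact ⟨q, ⟨h1, h2⟩, a, h3, rfl⟩
    · rintro ⟨q', ⟨h1, h2⟩, a', h3, h4⟩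
      cases h4
      exact ⟨h1, h2, h3⟩
  rw [hF]
  refine ⟨F.finite_toSet, ?_⟩
  rw [Set.ncard_coe_finset, Finset.card_biUnion]
  · refine Finset.sum_congr rfl fun q _ => ?_
    rw [Finset.card_map, Set.ncard_eq_toFinset_card _ (hs q)]
  · intro q _ q' _ hne
    rw [Function.onFun, Finset.disjoint_left]
    intro x hx hx'
    obtain ⟨_, _, rfl⟩ := Finset.mem_map.1 hx
    obtain ⟨_, _, h⟩ := Finset.mem_map.1 hx'
    exact hne (congrArg Prod.snd h).symm

/-! ### The almost sure asymptotics of the number of hits -/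

namespace DilatedLattice

variable {G : Type*} [Group G] [MeasurableSpace G] {μ : Measure G} (A : DilatedLattice G μ)

/-- The gauge is invariant under inversion, so the substitution `γ ↦ γ⁻¹` turns translates of `g`
near the identity into lattice points near `g`. -/
theorem count_eq_encard (r : ℝ) (g : G) :
    A.count r g = ({p | p ∈ A.lattice ∧ A.gauge (g⁻¹ * p) ≤ r}.encard : ℝ≥0∞) := by
  have h : {p | p ∈ A.lattice ∧ A.gauge (g⁻¹ * p) ≤ r} =
      Subtype.val '' {γ : A.lattice | A.gauge (g⁻¹ * γ) ≤ r} := by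
    ext p
    simp only [Set.mem_ofPred_eq, Set.mem_image, Subtype.exists, exists_and_right, exists_eq_right]
    exact ⟨fun h => ⟨h.1, h.2⟩, fun ⟨h1, h2⟩ => ⟨h1, h2⟩⟩
  rw [h, Subtype.val_injective.encard_image, ← ENNReal.tsum_set_one,
    tsum_subtype _ fun _ => (1 : ℝ≥0∞), count,
    ← (Equiv.inv A.lattice).tsum_eq]
  refine tsum_congr fun γ => ?_
  have hg : A.gauge ((Equiv.inv A.lattice γ : A.lattice) * g) = A.gauge (g⁻¹ * γ) := by
    rw [← A.gauge_inv, Equiv.inv_apply, Subgroup.coe_inv, mul_inv_rev, inv_inv]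
  simp only [ball, Set.indicator, Set.mem_ofPred_eq, hg]
  rfl

theorem hits_mul_left (C : ℝ) (q : ℕ) (γ : A.lattice) (g : G) :
    A.hits C q (γ * g) = A.hits C q g := by
  rw [hits, map_mul]
  exact congrArg ENNReal.toReal (A.count_mul_left _ (A.dilLattice q γ) _)

variable [MeasurableConstSMul G G] [SMulInvariantMeasure G G μ]

theorem finite_hits {C : ℝ} (hC : 0 ≤ C) (q : ℕ) (g : G) :
    {p | p ∈ A.lattice ∧ A.gauge ((A.dil q g)⁻¹ * p) ≤ A.radius C q}.Finite := by
  have := A.count_ne_top (A.radius_nonneg hC q) (A.dil q g)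
  rw [count_eq_encard, ENat.toENNReal_ne_top] at this
  exact Set.encard_ne_top_iff.1 this

theorem hits_eq_ncard {C : ℝ} (hC : 0 ≤ C) (q : ℕ) (g : G) :
    A.hits C q g = {p | p ∈ A.lattice ∧ A.gauge ((A.dil q g)⁻¹ * p) ≤ A.radius C q}.ncard := by
  rw [hits, count_eq_encard, ← (A.finite_hits hC q g).cast_ncard_eq]
  simp

theorem ae_isBigO_sum_hits (hdim : 3 ≤ A.dim) {C : ℝ} (hC : 0 ≤ C) {ε : ℝ} (hε : 0 < ε) :
    ∀ᵐ g ∂μ, (fun N : ℕ => ∑ q ∈ Finset.Icc 1 N, A.hits C q g -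
        A.vol * C ^ A.dim * Real.log N) =O[atTop]
      fun N : ℕ => Real.log N ^ (1 / 2 : ℝ) * Real.log (Real.log N) ^ (3 / 2 + ε) := by
  have := A.isProbabilityMeasure_restrict
  obtain ⟨K, hK0, hK⟩ := A.exists_integral_sq_sum_hits_le hdim hC
  have h := ae_isBigO_sum_sub_log (A.memLp_hits hC) (fun q g => ENNReal.toReal_nonneg)
    (mul_nonneg A.vol_nonneg (pow_nonneg hC A.dim)) hK0
    (fun M N => by simpa only [mul_assoc, div_eq_mul_inv] using hK M N) hε
  rw [ae_restrict_iff' A.measurableSet_domain] at h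
  -- The exceptional set is invariant under the lattice, so being null in the fundamental domain
  -- makes it null in `G`.
  refine A.isFundamentalDomain.measure_zero_of_invariant _ (fun γ => ?_) ?_
  · ext g
    rw [Set.mem_smul_set_iff_inv_smul_mem]
    change (¬ _ ↔ ¬ _)
    simp only [Subgroup.smul_def, smul_eq_mul, Set.mem_ofPred_eq, A.hits_mul_left]
  · rw [← nonpos_iff_eq_zero, ← ae_iff.1 h]
    refine measure_mono fun g hg => ?_
    rintro himp
    exact hg.1 (himp hg.2)

end DilatedLattice

/-! ### The integer lattice of a Carnot group and part (1) -/

namespace RationalCoordinates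

variable {L G ι : Type*} [LieRing L] [LieAlgebra ℝ L] [Group G] [Fintype ι] {S : CarnotGroup L G}

theorem ballConst_pos (R : RationalCoordinates S ι) {lam : ℕ → ℝ} (hlam : ∀ i, 0 < lam i) :
    0 < R.ballConst lam :=
  mul_pos (by positivity) (Finset.prod_pos fun _ _ => inv_pos.2 (hlam _))

/-- The integer lattice with the dilations and the gauge of rational coordinates. -/
theorem exists_dilatedLattice [Nonempty ι] [MeasurableSpace G] (R : RationalCoordinates S ι)
    (e : G ≃ᵐ (ι → ℝ)) (he : ∀ g, e g = R.coord g) (lam : ℕ → ℝ) (hlam : ∀ i, 0 < lam i)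
    (htri : ∀ x y z : G, R.infDist lam x z ≤ R.infDist lam x y + R.infDist lam y z) :
    ∃ A : DilatedLattice G (volume.map e.symm), A.lattice = R.lattice ∧ A.dil = R.dilationHom ∧
      A.dim = R.homDim ∧ A.gauge = R.infNorm lam ∧ A.vol = R.ballConst lam := by
  obtain ⟨c, hc0, hc⟩ := R.exists_infNorm_le_of_mem_unitCube lam hlam
  exact ⟨{ lattice := R.lattice
           countable_lattice := R.countable_integerPoints.to_subtype
           domain := R.unitCube
           existsUnique_mul_mem := R.existsUnique_smul_mem
           measurableSet_domain := R.measurableSet_unitCube e he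
           measure_domain := R.measure_unitCube e he
           dil := R.dilationHom
           measurable_dil := fun n => R.measurable_dilation_of_coord e he n
           dil_bijective := fun n hn => R.dilationHom_bijective hn
           dil_mem := fun n g hg => R.dilationHom_mem_lattice n hg
           mem_of_coprime := fun a b hab g ha hb => R.mem_lattice_of_coprime hab ha hb
           dim := R.homDim
           smul_map_dil := fun n hn => by
             have := R.smul_map_dilation e he (Nat.cast_pos.2 (Nat.pos_of_ne_zero hn))
             rwa [ENNReal.ofReal_pow (Nat.cast_nonneg n), ENNReal.ofReal_natCast] at this
           gauge := R.infNorm lam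
           measurable_gauge := R.measurable_infNorm_of_coord e he lam
           gauge_inv := R.infNorm_inv lam
           gauge_mul_le := R.infNorm_mul_le lam htri
           gauge_dil := fun n g => R.infNorm_dilation lam (Nat.cast_nonneg n) g
           vol := R.ballConst lam
           vol_nonneg := (R.ballConst_pos hlam).le
           measure_gauge_le := fun r hr => R.measure_infNorm_le e he lam hlam hr
           diam := c
           diam_nonneg := hc0
           gauge_le_diam := hc }, rfl, rfl, rfl, rfl, rfl⟩

theorem infDist_dilation_inv_le_iff [Nonempty ι] (R : RationalCoordinates S ι) (lam : ℕ → ℝ)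
    (hQ : R.homDim ≠ 0) (C : ℝ) (g p : G) {q : ℕ} (hq : q ≠ 0) :
    R.infDist lam g (R.dilation ((q : ℝ)⁻¹) p) ≤
        C * (q : ℝ) ^ (-(((R.homDim : ℝ) + 1) / (R.homDim : ℝ))) ↔
      R.infNorm lam ((R.dilationHom q g)⁻¹ * p) ≤ C * (q : ℝ) ^ (-(1 / (R.homDim : ℝ))) := by
  have hq0 : (0 : ℝ) < q := Nat.cast_pos.2 (Nat.pos_of_ne_zero hq)
  have hQ' : (R.homDim : ℝ) ≠ 0 := Nat.cast_ne_zero.2 hQ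
  have h1 : R.infNorm lam ((R.dilationHom q g)⁻¹ * p) =
      q * R.infDist lam g (R.dilation ((q : ℝ)⁻¹) p) := by
    rw [infDist, ← R.infNorm_dilation lam hq0.le, ← dilationHom_apply, map_mul, map_inv,
      dilationHom_apply _ _ (R.dilation _ p), dilation_dilation, mul_inv_cancel₀ hq0.ne',
      dilation_one]
  have h2 : (q : ℝ) ^ (-(1 / (R.homDim : ℝ))) =
      q * (q : ℝ) ^ (-(((R.homDim : ℝ) + 1) / (R.homDim : ℝ))) := by
    rw [← Real.rpow_one_add' hq0.le]
    · congr 1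
      field_simp
      ring
    · field_simp
      ring_nf
      simpa using hQ'
  rw [h1, h2, mul_left_comm, mul_le_mul_iff_right₀ hq0]

/-- The counting function of part (1), for all constants `C` and all points of the group. -/
theorem solutions_infDist (R : RationalCoordinates S ι) (hQ : 3 ≤ R.homDim)
    (lam : ℕ → ℝ) (hlam : ∀ i, 0 < lam i)
    (htri : ∀ x y z : G, R.infDist lam x z ≤ R.infDist lam x y + R.infDist lam y z)
    {C : ℝ} (hC : 0 ≤ C) :
    (∀ (g : G) (N : ℕ), (R.solutions (R.infDist lam) C g N).Finite) ∧
      ∀ ε : ℝ, 0 < ε → ∀ᵐ x ∂(volume : Measure (ι → ℝ)),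
        (fun N : ℕ => ((R.solutions (R.infDist lam) C (R.point x) N).ncard : ℝ)
            - R.ballConst lam * C ^ R.homDim * Real.log N)
          =O[atTop] fun N : ℕ =>
            Real.log N ^ (1 / 2 : ℝ) * Real.log (Real.log N) ^ (3 / 2 + ε) := by
  have hne : Nonempty ι := by
    by_contra h
    rw [not_nonempty_iff] at h
    simp [homDim] at hQ
  -- `G` carries no measurable structure of its own; it is pulled back from the coordinates, which
  -- makes them a measurable equivalence.
  let _ : MeasurableSpace G := MeasurableSpace.comap R.coord inferInstance
  let e : G ≃ᵐ (ι → ℝ) :=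
    { toFun := R.coord
      invFun := R.point
      left_inv := R.point_coord
      right_inv := R.coord_point
      measurable_toFun := comap_measurable R.coord
      measurable_invFun := measurable_comap_iff.2 (by
        have : R.coord ∘ R.point = id := funext R.coord_point
        exact this ▸ measurable_id) }
  have he : ∀ g, e g = R.coord g := fun _ => rfl
  have : MeasurableConstSMul G G := ⟨R.measurable_mul_left_of_coord e he⟩
  have : SMulInvariantMeasure G G (volume.map e.symm) :=
    ⟨fun g _ hs => (R.measurePreserving_mul_left_of_coord e he g).measure_preimage
      hs.nullMeasurableSet⟩
  obtain ⟨A, h1, h2, h3, h4, h5⟩ := R.exists_dilatedLattice e he lam hlam htri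
  have hsol : ∀ g N, R.solutions (R.infDist lam) C g N = {s : G × ℕ | 1 ≤ s.2 ∧ s.2 ≤ N ∧
      s.1 ∈ {p | p ∈ A.lattice ∧ A.gauge ((A.dil s.2 g)⁻¹ * p) ≤ A.radius C s.2}} := by
    intro g N
    ext ⟨p, q⟩
    simp only [solutions, Set.mem_ofPred_eq, h1, h2, h4, DilatedLattice.radius, h3]
    have hmem : p ∈ R.lattice ↔ p ∈ R.integerPoints := Iff.rfl
    rw [hmem]
    constructor
    · rintro ⟨a, b, c, d⟩
      exact ⟨b, c, a, (R.infDist_dilation_inv_le_iff lam (by omega) C g p (by omega)).1 d⟩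
    · rintro ⟨b, c, a, d⟩
      exact ⟨a, b, c, (R.infDist_dilation_inv_le_iff lam (by omega) C g p (by omega)).2 d⟩
  have hcount := fun g N => finite_and_ncard_prod_nat _ (fun q => A.finite_hits hC q g) N
  refine ⟨fun g N => by rw [hsol]; exact (hcount g N).1, fun ε hε => ?_⟩
  have hae := A.ae_isBigO_sum_hits (by omega) hC hε
  have hae' := ae_of_ae_map e.symm.measurable.aemeasurable hae
  filter_upwards [hae'] with x hx
  rw [h3, h5] at hx
  refine hx.congr_left fun N => ?_
  rw [hsol]
  have := (hcount (R.point x) N).2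
  rw [this, Nat.cast_sum]
  congr 1
  exact Finset.sum_congr rfl fun q _ => A.hits_eq_ncard hC q _

end RationalCoordinates

/-! ### Comparison of metrics and the main theorem -/

theorem isLittleO_sqrt_mul_log_rpow (t : ℝ) :
    (fun N : ℕ => Real.log N ^ (1 / 2 : ℝ) * Real.log (Real.log N) ^ t)
      =o[atTop] fun N : ℕ => Real.log N := by
  have t1 : Tendsto (fun N : ℕ => Real.log N) atTop atTop :=
    Real.tendsto_log_atTop.comp tendsto_natCast_atTop_atTop
  have h := (isBigO_refl (fun x : ℝ => x ^ (1 / 2 : ℝ)) atTop).mul_isLittleO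
    (isLittleO_log_rpow_rpow_atTop t (show (0 : ℝ) < 1 / 2 by norm_num))
  refine (h.comp_tendsto t1).congr' EventuallyEq.rfl ?_
  filter_upwards [t1.eventually_gt_atTop 0] with N hN
  simp only [Function.comp_apply]
  rw [← Real.rpow_add hN]
  norm_num

theorem eventually_bounds_of_isBigO {u : ℕ → ℝ} {a t : ℝ} (ha : 0 < a)
    (h : (fun N : ℕ => u N - a * Real.log N) =O[atTop]
      fun N : ℕ => Real.log N ^ (1 / 2 : ℝ) * Real.log (Real.log N) ^ t) :
    ∀ᶠ N : ℕ in atTop, a / 2 * Real.log N ≤ u N ∧ u N ≤ 2 * a * Real.log N := by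
  filter_upwards [(h.trans_isLittleO (isLittleO_sqrt_mul_log_rpow t)).bound (half_pos ha),
    eventually_ge_atTop 1] with N hN h1
  have h0 : 0 ≤ Real.log N := Real.log_nonneg (by exact_mod_cast h1)
  rw [Real.norm_eq_abs, Real.norm_of_nonneg h0, abs_le] at hN
  have := mul_nonneg ha.le h0
  constructor <;> linarith [hN.1, hN.2]

theorem eventually_half_log_le_log_pred :
    ∀ᶠ N : ℕ in atTop, 1 / 2 * Real.log N ≤ Real.log (N - 1 : ℕ) := by
  have t1 : Tendsto (fun N : ℕ => Real.log N) atTop atTop :=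
    Real.tendsto_log_atTop.comp tendsto_natCast_atTop_atTop
  filter_upwards [t1.eventually_ge_atTop 2, eventually_ge_atTop 2] with N h1 h2
  have h3 : Real.log N ≤ Real.log (2 * (N - 1 : ℕ) : ℕ) :=
    Real.log_le_log (by positivity) (Nat.cast_le.2 (by omega))
  have h4 : ((N - 1 : ℕ) : ℝ) ≠ 0 := Nat.cast_ne_zero.2 (by omega)
  rw [Nat.cast_mul, Nat.cast_ofNat, Real.log_mul two_ne_zero h4] at h3
  linarith [Real.log_two_lt_d9]

theorem theorem2p2 {L G ι : Type*} [LieRing L] [LieAlgebra ℝ L] [Group G] [Fintype ι]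
    (S : CarnotGroup L G) (R : RationalCoordinates S ι) (hQ : 3 ≤ R.homDim)
    (lam : ℕ → ℝ) (hlam : ∀ i, 0 < lam i)
    (htri : ∀ x y z : G, R.infDist lam x z ≤ R.infDist lam x y + R.infDist lam y z)
    (C : ℝ) (hC : 0 < C) :
    ((∀ (g : G) (N : ℕ), (R.solutions (R.infDist lam) C g N).Finite) ∧
      ∀ ε : ℝ, 0 < ε → ∀ᵐ x ∂(volume : Measure (ι → ℝ)),
        (fun N : ℕ => ((R.solutions (R.infDist lam) C (R.point x) N).ncard : ℝ)
            - R.ballConst lam * C ^ R.homDim * Real.log N)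
          =O[atTop] fun N : ℕ =>
            Real.log N ^ (1 / 2 : ℝ) * Real.log (Real.log N) ^ (3 / 2 + ε)) ∧
    ∀ (ρ : G → G → ℝ) (K : ℝ), 0 < K →
      (∀ g h : G, K⁻¹ * R.infDist lam g h ≤ ρ g h ∧ ρ g h ≤ K * R.infDist lam g h) →
      (∀ (g : G) (N : ℕ), (R.solutions ρ C g N).Finite) ∧
      ∃ c₁ c₂ : ℝ, 0 < c₁ ∧ 0 < c₂ ∧ ∀ᵐ x ∂(volume : Measure (ι → ℝ)), ∀ᶠ N : ℕ in atTop,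
        c₁ * Real.log N ≤ ((R.strictSolutions ρ C (R.point x) N).ncard : ℝ) ∧
        ((R.solutions ρ C (R.point x) N).ncard : ℝ) ≤ c₂ * Real.log N := by
  refine ⟨R.solutions_infDist hQ lam hlam htri hC.le, fun ρ K hK hρ => ?_⟩
  obtain ⟨hfin₁, hO₁⟩ := R.solutions_infDist hQ lam hlam htri (C := K * C) (by positivity)
  -- The factor `K` passes from `d` to `ρ`; the factor `2` turns a weak inequality into a strict
  -- one.
  obtain ⟨-, hO₂⟩ := R.solutions_infDist hQ lam hlam htri (C := C / (2 * K)) (by positivity)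
  have hsub₁ : ∀ g N, R.solutions ρ C g N ⊆ R.solutions (R.infDist lam) (K * C) g N := by
    rintro g N ⟨p, q⟩ ⟨h1, h2, h3, h4⟩
    refine ⟨h1, h2, h3, ?_⟩
    have := (hρ g (R.dilation ((q : ℝ)⁻¹) p)).1.trans h4
    rwa [inv_mul_le_iff₀ hK, ← mul_assoc] at this
  have hfin : ∀ g N, (R.solutions ρ C g N).Finite := fun g N => (hfin₁ g N).subset (hsub₁ g N)
  have hsub₂ : ∀ g N, R.strictSolutions ρ C g N ⊆ R.solutions ρ C g N := by
    rintro g N ⟨p, q⟩ ⟨h1, h2, h3, h4⟩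
    exact ⟨h1, h2, le_of_lt h3, le_of_lt h4⟩
  have hsub₃ : ∀ g N, R.solutions (R.infDist lam) (C / (2 * K)) g (N - 1) ⊆
      R.strictSolutions ρ C g N := by
    rintro g N ⟨p, q⟩ ⟨h1, h2, h3, h4⟩
    simp only at h2 h3 h4
    refine ⟨h1, h2, show q < N by omega, ?_⟩
    have hq : (0 : ℝ) < q := Nat.cast_pos.2 h2
    have hpow : 0 < (q : ℝ) ^ (-(((R.homDim : ℝ) + 1) / (R.homDim : ℝ))) :=
      Real.rpow_pos_of_pos hq _
    calc ρ g (R.dilation ((q : ℝ)⁻¹) p) ≤ K * R.infDist lam g (R.dilation ((q : ℝ)⁻¹) p) :=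
          (hρ _ _).2
      _ ≤ K * (C / (2 * K) * (q : ℝ) ^ (-(((R.homDim : ℝ) + 1) / (R.homDim : ℝ)))) := by gcongr
      _ = C / 2 * (q : ℝ) ^ (-(((R.homDim : ℝ) + 1) / (R.homDim : ℝ))) := by field_simp
      _ < C * (q : ℝ) ^ (-(((R.homDim : ℝ) + 1) / (R.homDim : ℝ))) := by gcongr; linarith
  have hB := R.ballConst_pos hlam
  have ha₁ : 0 < R.ballConst lam * (K * C) ^ R.homDim := by positivity
  have ha₂ : 0 < R.ballConst lam * (C / (2 * K)) ^ R.homDim := by positivity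
  -- The `4` in `c₁` combines a loss of `2` in the asymptotics with a loss of `2` in `log (N - 1) ≥
  -- (log N) / 2`, needed because `q < N` means `q ≤ N - 1`.
  refine ⟨hfin, R.ballConst lam * (C / (2 * K)) ^ R.homDim / 4,
    2 * (R.ballConst lam * (K * C) ^ R.homDim), by positivity, by positivity, ?_⟩
  filter_upwards [hO₁ 1 one_pos, hO₂ 1 one_pos] with x hx₁ hx₂
  filter_upwards [eventually_bounds_of_isBigO ha₁ hx₁,
    (tendsto_sub_atTop_nat 1).eventually (eventually_bounds_of_isBigO ha₂ hx₂),
    eventually_half_log_le_log_pred] with N h1 h2 h3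
  constructor
  · calc _ = R.ballConst lam * (C / (2 * K)) ^ R.homDim / 2 * (1 / 2 * Real.log N) := by ring
      _ ≤ R.ballConst lam * (C / (2 * K)) ^ R.homDim / 2 * Real.log (N - 1 : ℕ) := by gcongr
      _ ≤ _ := h2.1
      _ ≤ _ := Nat.cast_le.2 (Set.ncard_le_ncard (hsub₃ _ _)
          ((hfin _ _).subset (hsub₂ _ _)))
  · exact (Nat.cast_le.2 (Set.ncard_le_ncard (hsub₁ _ _) (hfin₁ _ _))).trans h1.2
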